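/- Let $0<p<1$ and let $d\ge 2$ be an integer. There exist a constant $\varepsilon>0$ and a Borel probability measure $\mu$ on $\mathrm{SL}_d(\mathbb{R})$ such that - $\mu$ is symmetric, i.e. invariant under push-forward by $g\mapsto g^{-1}$; - $\mu$ has finite $L^p$-moment, i.e. $\int (\log\|g\|)^p\,d\mu(g)<\infty$, where $\|\cdot\|$ is the operator norm induced by the Euclidean norm on $\mathbb{R}^d$; - $\mu$ has no atoms; - the support of $\mu$ is all of $\mathrm{SL}_d(\mathbb{R})$; - for every compact $K\subset \mathrm{SL}_d(\mathbb{R})/\mathrm{SL}_d(\mathbb{Z})$, $$\liminf_{n\to+\infty}\frac1n\sum_{k=1}^n \mu^{*k}\bigl(K\cdot \mathrm{SL}_d(\mathbb{Z})\bigr)\le 1-\varepsilon .$$ Here $\mu^{*k}$ is the $k$-fold convolution power of $\mu$, and $K\cdot\mathrm{SL}_d(\mathbb{Z})\subset\mathrm{SL}_d(\mathbb{R})$ is the union of the cosets belonging to $K$. -/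

import Mathlib

open MeasureTheory Filter

/-- The real special linear group `SL_d(ℝ)`, with Mathlib's topology (induced from matrices). -/
abbrev SLR (d : ℕ) : Type := Matrix.SpecialLinearGroup (Fin d) ℝ

/-- `SL_d(ℝ)` carries its Borel σ-algebra. -/
instance instMeasurableSpaceSLR (d : ℕ) : MeasurableSpace (SLR d) := borel (SLR d)

instance instBorelSpaceSLR (d : ℕ) : BorelSpace (SLR d) := ⟨rfl⟩

/-- `SL_d(ℤ)` as a subgroup of `SL_d(ℝ)`. -/
def SLZ (d : ℕ) : Subgroup (SLR d) :=
  (Matrix.SpecialLinearGroup.map (n := Fin d) (Int.castRingHom ℝ)).range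

/-- The space of unimodular lattices `SL_d(ℝ) / SL_d(ℤ)`, with the quotient topology. -/
abbrev LatticeSpace (d : ℕ) : Type := SLR d ⧸ SLZ d

/-- For a set `K` of cosets, `K · SL_d(ℤ) ⊆ SL_d(ℝ)`: the union of the cosets in `K`. -/
def cosetUnion {d : ℕ} (K : Set (LatticeSpace d)) : Set (SLR d) :=
  {g | (QuotientGroup.mk g : LatticeSpace d) ∈ K}

/-- The operator norm of `g` for the Euclidean norm on `ℝ^d`. -/
noncomputable def opNorm {d : ℕ} (g : SLR d) : ℝ :=
  ‖Matrix.toEuclideanCLM (n := Fin d) (𝕜 := ℝ) (g : Matrix (Fin d) (Fin d) ℝ)‖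

/-- Finite `L^p`-moment: `∫ (log ‖g‖)^p dμ(g) < ∞`.
(For `d ≥ 1` one has `‖g‖ ≥ 1` on `SL_d(ℝ)`, so the integrand is nonnegative.) -/
def HasFiniteLpMoment {d : ℕ} (p : ℝ) (μ : Measure (SLR d)) : Prop :=
  ∫⁻ g, ENNReal.ofReal (Real.log (opNorm g) ^ p) ∂μ < ⊤

/-- The `k`-fold convolution power `μ^{*k}`, with `μ^{*0}` the Dirac mass at the identity. -/
noncomputable def convPow {d : ℕ} (μ : Measure (SLR d)) : ℕ → Measure (SLR d)
  | 0 => Measure.dirac 1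
  | k + 1 => Measure.mconv (convPow μ k) μ

open scoped Pointwise ENNReal Topology

/-! The measure is a mixture over levels `J`, a level at least `J` having probability `W J`. At
level `J` one takes either the `J`-th term of an enumeration of `SL_d(ℚ)`, which yields full
support, or a rational diagonal matrix `A J` dividing a basis vector `e` by a huge factor `t J`. The
matrix is multiplied by a shear whose parameter is random and non-atomic, which removes atoms, and
the law is symmetrized.

For `J ≥ 1`, `W J = 1 / (2 N_J)`. Thus for `k ≤ N_J`, with probability at least `k / (32 N_J)`,
exactly one of `k` factors is a level-`J` stretch and all others come from lower levels
(`exists_oneJump_measure`, `average_le`). Such a product has the form `x a y`. The lower levels are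
rational with denominators controlled by `R_J`, up to noise of order `1 / E_J`, so `y` maps some
integer vector `v` very close to a power of `R_J` times `e`. The stretch makes this vector tiny, and
`x` cannot undo it because `t J` exceeds every norm that can be accumulated in `N_J` steps
(`exists_short_vector`). The lattice then has a nonzero vector of length at most `2 / (J + 1)`, so
for large `J` it lies outside a given compact set (`exists_systole_bound`). Averaging over `k ≤ N_J`
loses at least `1 / 64`.

The moment is finite because `log (t J)` grows linearly in `N_J` once `R_J` is fixed. As `p < 1`, a
large `N_J` makes its `p`-th power at most `N_J 2^{-J}`, while the weight is of order `1 / N_J`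
(`exists_rpow_log_le`). The parameters are chosen in the order `R_J`, `N_J`, `t J`, `E_J`, `R_{J+1}`
(`exists_parameters`). -/

instance instSecondCountableSLR (d : ℕ) : SecondCountableTopology (SLR d) :=
  haveI : SecondCountableTopology (Matrix (Fin d) (Fin d) ℝ) :=
    inferInstanceAs (SecondCountableTopology (Fin d → Fin d → ℝ))
  Topology.IsInducing.subtypeVal.secondCountableTopology

/-! ### Products with exactly one distinguished factor. -/

section OneJump

variable {G : Type*} [Group G]

/-- Products of `k` factors, exactly one of which lies in `F` and the others in `E`. -/
def oneJump (E F : Set G) : ℕ → Set G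
  | 0 => ∅
  | k + 1 => oneJump E F k * E ∪ E ^ k * F

theorem exists_of_mem_oneJump {E F : Set G} {k : ℕ} {g : G} (hg : g ∈ oneJump E F k) :
    ∃ i j, i + j + 1 = k ∧ g ∈ E ^ i * F * E ^ j := by
  induction k generalizing g with
  | zero => exact hg.elim
  | succ k ih =>
    rcases hg with hg | hg
    · obtain ⟨x, hx, e, he, rfl⟩ := hg
      obtain ⟨i, j, hij, hx⟩ := ih hx
      refine ⟨i, j + 1, by omega, ?_⟩
      rw [pow_succ, ← mul_assoc]
      exact Set.mul_mem_mul hx he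
    · exact ⟨k, 0, by omega, by simpa using hg⟩

variable [TopologicalSpace G] [IsTopologicalGroup G]

theorem IsCompact.set_pow {A : Set G} (hA : IsCompact A) (k : ℕ) : IsCompact (A ^ k) := by
  induction k with
  | zero => simp [← Set.singleton_one]
  | succ k ih => rw [pow_succ]; exact ih.mul hA

theorem isCompact_oneJump {E F : Set G} (hE : IsCompact E) (hF : IsCompact F) (k : ℕ) :
    IsCompact (oneJump E F k) := by
  induction k with
  | zero => exact isCompact_empty
  | succ k ih => exact (ih.mul hE).union ((hE.set_pow k).mul hF)

end OneJump

/-! ### Mass, monotonicity and carriers of convolutions. -/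

section Convolution

variable {G : Type*} [Group G] [TopologicalSpace G] [IsTopologicalGroup G]
  [SecondCountableTopology G] [MeasurableSpace G] [BorelSpace G]

theorem mconv_apply_univ (α β : Measure G) [SFinite β] :
    (α.mconv β) Set.univ = α Set.univ * β Set.univ := by
  rw [Measure.mconv, Measure.map_apply (by fun_prop) MeasurableSet.univ, Set.preimage_univ,
    ← Set.univ_prod_univ, Measure.prod_prod]

theorem mconv_mono {α α' β β' : Measure G} [SFinite β'] (h : α ≤ α') (h' : β ≤ β') :
    α.mconv β ≤ α'.mconv β' :=
  Measure.map_mono (Measure.prod_mono h h') (by fun_prop)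

/-- Compactness serves only to make `A * B` measurable; a product of two measurable sets need not
be. -/
theorem mconv_compl_mul_eq_zero [T2Space G] {α β : Measure G} [SFinite α] [SFinite β] {A B : Set G}
    (hA : IsCompact A) (hB : IsCompact B) (hα : α Aᶜ = 0) (hβ : β Bᶜ = 0) :
    (α.mconv β) (A * B)ᶜ = 0 := by
  rw [Measure.mconv, Measure.map_apply (by fun_prop) (hA.mul hB).measurableSet.compl]
  have hsub : (fun x : G × G => x.1 * x.2) ⁻¹' (A * B)ᶜ ⊆
      (Aᶜ ×ˢ Set.univ) ∪ (Set.univ ×ˢ Bᶜ) := by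
    rintro ⟨x, y⟩ hxy
    by_contra hcon
    simp only [Set.mem_union, Set.mem_prod, Set.mem_compl_iff, Set.mem_univ, and_true, true_and,
      not_or, not_not] at hcon
    exact hxy (Set.mul_mem_mul hcon.1 hcon.2)
  refine measure_mono_null hsub (measure_union_null ?_ ?_) <;> simp [Measure.prod_prod, hα, hβ]

end Convolution

/-! ### Convolution powers and the one-jump lower bound. -/

section ConvPow

variable {d : ℕ}

instance isFiniteMeasure_convPow (μ : Measure (SLR d)) [IsFiniteMeasure μ] (k : ℕ) :
    IsFiniteMeasure (convPow μ k) := by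
  induction k with
  | zero => unfold convPow; infer_instance
  | succ k ih => unfold convPow; infer_instance

instance isProbabilityMeasure_convPow (μ : Measure (SLR d)) [IsProbabilityMeasure μ] (k : ℕ) :
    IsProbabilityMeasure (convPow μ k) := by
  induction k with
  | zero => unfold convPow; infer_instance
  | succ k ih => unfold convPow; infer_instance

theorem convPow_apply_univ (α : Measure (SLR d)) [IsFiniteMeasure α] (k : ℕ) :
    convPow α k Set.univ = α Set.univ ^ k := by
  induction k with
  | zero => simp [convPow]
  | succ k ih => rw [convPow, mconv_apply_univ, ih, pow_succ]

theorem convPow_compl_pow_eq_zero {α : Measure (SLR d)} [IsFiniteMeasure α] {E : Set (SLR d)}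
    (hE : IsCompact E) (hα : α Eᶜ = 0) (k : ℕ) : convPow α k (E ^ k)ᶜ = 0 := by
  induction k with
  | zero => simp [convPow, ← Set.singleton_one]
  | succ k ih =>
    rw [convPow, pow_succ]
    exact mconv_compl_mul_eq_zero (hE.set_pow k) hE ih hα

/-- If `α + β ≤ μ`, then `μ^{*k}` dominates `α^{*k}` plus a measure of mass `k α(G)^{k-1} β(G)`
carried by the products with exactly one factor in the carrier of `β`. -/
theorem exists_oneJump_measure {μ α β : Measure (SLR d)} [IsFiniteMeasure μ] [IsFiniteMeasure α]
    [IsFiniteMeasure β] (h : α + β ≤ μ) {E F : Set (SLR d)} (hE : IsCompact E) (hF : IsCompact F)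
    (hα : α Eᶜ = 0) (hβ : β Fᶜ = 0) (k : ℕ) :
    ∃ γ : Measure (SLR d), IsFiniteMeasure γ ∧ convPow α k + γ ≤ convPow μ k ∧
      γ Set.univ = k * α Set.univ ^ (k - 1) * β Set.univ ∧ γ (oneJump E F k)ᶜ = 0 := by
  induction k with
  | zero => exact ⟨0, inferInstance, by simp [convPow], by simp, by simp⟩
  | succ k ih =>
    obtain ⟨γ, hfin, hle, hmass, hsupp⟩ := ih
    -- The summands correspond to the jump occurring before the last factor, or at it.
    refine ⟨γ.mconv α + (convPow α k).mconv β, inferInstance, ?_, ?_, ?_⟩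
    · calc convPow α (k + 1) + (γ.mconv α + (convPow α k).mconv β)
          = (convPow α k + γ).mconv α + (convPow α k).mconv β := by
            rw [Measure.add_mconv, convPow, add_assoc]
        _ ≤ (convPow α k + γ).mconv α + (convPow α k + γ).mconv β :=
            add_le_add le_rfl (mconv_mono (Measure.le_add_right le_rfl) le_rfl)
        _ = (convPow α k + γ).mconv (α + β) := by rw [Measure.mconv_add]
        _ ≤ convPow μ (k + 1) := mconv_mono hle h
    · rw [Measure.add_apply, mconv_apply_univ, mconv_apply_univ, hmass, convPow_apply_univ]
      rcases k with _ | k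
      · simp
      · simp only [Nat.add_sub_cancel]
        push_cast
        ring
    · rw [Measure.add_apply]
      have h1 : γ.mconv α (oneJump E F (k + 1))ᶜ = 0 :=
        measure_mono_null (Set.compl_subset_compl.2 Set.subset_union_left)
          (mconv_compl_mul_eq_zero (isCompact_oneJump hE hF k) hE hsupp hα)
      have h2 : (convPow α k).mconv β (oneJump E F (k + 1))ᶜ = 0 :=
        measure_mono_null (Set.compl_subset_compl.2 Set.subset_union_right)
          (mconv_compl_mul_eq_zero (hE.set_pow k) hF (convPow_compl_pow_eq_zero hE hα k) hβ)
      rw [h1, h2, add_zero]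

/-- The one-jump measure sits below `convPow μ k` and is carried by a set that `S` misses, so its
whole mass is lost to `S`. -/
theorem convPow_real_le {μ α β : Measure (SLR d)} [IsProbabilityMeasure μ] [IsFiniteMeasure α]
    [IsFiniteMeasure β] (h : α + β ≤ μ) {E F : Set (SLR d)} (hE : IsCompact E) (hF : IsCompact F)
    (hα : α Eᶜ = 0) (hβ : β Fᶜ = 0) (k : ℕ) {S : Set (SLR d)}
    (hS : Disjoint S (oneJump E F k)) :
    (convPow μ k).real S ≤ 1 - k * α.real Set.univ ^ (k - 1) * β.real Set.univ := by
  obtain ⟨γ, hfin, hle, hmass, hsupp⟩ := exists_oneJump_measure h hE hF hα hβ k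
  have hm := (isCompact_oneJump hE hF k).measurableSet
  have h1 : (convPow μ k).real S ≤ (convPow μ k).real (oneJump E F k)ᶜ :=
    measureReal_mono hS.subset_compl_right
  have h2 : γ (oneJump E F k) = γ Set.univ := by
    rw [← measure_add_measure_compl hm, hsupp, add_zero]
  have h3 : γ.real Set.univ ≤ (convPow μ k).real (oneJump E F k) := by
    rw [measureReal_def, ← h2]
    exact ENNReal.toReal_mono (measure_ne_top _ _) ((Measure.le_add_left le_rfl).trans hle _)
  have h4 : γ.real Set.univ = k * α.real Set.univ ^ (k - 1) * β.real Set.univ := by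
    rw [measureReal_def, hmass]
    simp [measureReal_def]
  rw [probReal_compl_eq_one_sub hm] at h1
  linarith

end ConvPow

/-! ### Nearly integral matrices, short lattice vectors and Mahler's criterion. -/

section Lattice

variable {d : ℕ}

/-- The integer vector `w`, seen in `ℝ^d`. -/
def intVec (w : Fin d → ℤ) : Fin d → ℝ := fun i => (w i : ℝ)

/-- `A` has operator norm at most `c` for the sup norm. -/
def SupBound (c : ℝ) (A : Matrix (Fin d) (Fin d) ℝ) : Prop :=
  ∀ v, ‖A.mulVec v‖ ≤ c * ‖v‖

theorem SupBound.mul {a b : ℝ} {A B : Matrix (Fin d) (Fin d) ℝ} (ha : 0 ≤ a) (hA : SupBound a A)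
    (hB : SupBound b B) : SupBound (a * b) (A * B) := fun v => by
  rw [← Matrix.mulVec_mulVec, mul_assoc]
  exact (hA _).trans (mul_le_mul_of_nonneg_left (hB v) ha)

theorem SupBound.mono {a b : ℝ} {A : Matrix (Fin d) (Fin d) ℝ} (hA : SupBound a A) (h : a ≤ b) :
    SupBound b A := fun v => (hA v).trans (mul_le_mul_of_nonneg_right h (norm_nonneg v))

theorem supBound_one : SupBound 1 (1 : Matrix (Fin d) (Fin d) ℝ) := fun v => by simp

theorem supBound_sum_abs (A : Matrix (Fin d) (Fin d) ℝ) :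
    SupBound (∑ i, ∑ j, |A i j|) A := fun v => by
  have h0 : 0 ≤ ∑ i, ∑ j, |A i j| := by positivity
  rw [pi_norm_le_iff_of_nonneg (by positivity)]
  intro i
  have h1 : ∑ j, |A i j| ≤ ∑ i, ∑ j, |A i j| :=
    Finset.single_le_sum (f := fun i => ∑ j, |A i j|) (fun i _ => by positivity)
      (Finset.mem_univ i)
  calc ‖A.mulVec v i‖ ≤ ∑ j, ‖A i j * v j‖ := norm_sum_le Finset.univ fun j => A i j * v j
    _ ≤ ∑ j, |A i j| * ‖v‖ := Finset.sum_le_sum fun j _ => by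
        rw [norm_mul, Real.norm_eq_abs]
        exact mul_le_mul_of_nonneg_left (norm_le_pi_norm v j) (abs_nonneg _)
    _ = (∑ j, |A i j|) * ‖v‖ := by rw [Finset.sum_mul]
    _ ≤ _ := mul_le_mul_of_nonneg_right h1 (norm_nonneg v)

theorem one_le_norm_intVec {w : Fin d → ℤ} (hw : w ≠ 0) : 1 ≤ ‖intVec w‖ := by
  obtain ⟨i, hi⟩ := Function.ne_iff.1 hw
  refine le_trans ?_ (norm_le_pi_norm (intVec w) i)
  rw [intVec, Real.norm_eq_abs, ← Int.cast_abs]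
  exact_mod_cast Int.one_le_abs hi

theorem intVec_mulVec (Z : Matrix (Fin d) (Fin d) ℤ) (w : Fin d → ℤ) :
    (Z.map (Int.cast : ℤ → ℝ)).mulVec (intVec w) = intVec (Z.mulVec w) := by
  ext i
  simp [Matrix.mulVec, dotProduct, intVec]

/-- `g` has norm at most `R` and maps `ℤ^d`, up to a relative error `δ`, onto a set
containing `R ℤ^d`. -/
def NearIntegral (R δ : ℝ) (g : SLR d) : Prop :=
  SupBound R (g : Matrix (Fin d) (Fin d) ℝ) ∧ ∀ w : Fin d → ℤ, ∃ v : Fin d → ℤ,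
    ‖intVec v‖ ≤ R ^ 2 * ‖intVec w‖ ∧
      ‖(g : Matrix (Fin d) (Fin d) ℝ).mulVec (intVec v) - R • intVec w‖ ≤ δ * ‖intVec v‖

variable {R δ : ℝ} {S : Set (SLR d)}

theorem supBound_of_mem_pow (hR : 1 ≤ R) (hS : ∀ g ∈ S, NearIntegral R δ g) {k : ℕ} {g : SLR d}
    (hg : g ∈ S ^ k) : SupBound (R ^ k) (g : Matrix (Fin d) (Fin d) ℝ) := by
  induction k generalizing g with
  | zero =>
    rw [pow_zero, Set.mem_one] at hg
    simpa [hg] using supBound_one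
  | succ k ih =>
    rw [pow_succ] at hg
    obtain ⟨x, hx, y, hy, rfl⟩ := hg
    rw [pow_succ]
    exact (ih hx).mul (by positivity) (hS y hy).1

/-- Preimages are taken one factor at a time, from the left: each factor costs a multiple `R` of the
target, which clears denominators and keeps the preimage integral. Earlier errors are amplified by
at most `R`, and preimages grow by at most `R ^ 2`; the exponent `4 * k` absorbs both. -/
theorem exists_intVec_of_mem_pow (hR : 1 ≤ R) (hδ : 0 ≤ δ) (hS : ∀ g ∈ S, NearIntegral R δ g)
    {k : ℕ} {g : SLR d} (hg : g ∈ S ^ k) (w : Fin d → ℤ) : ∃ v : Fin d → ℤ,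
      ‖(g : Matrix (Fin d) (Fin d) ℝ).mulVec (intVec v) - R ^ k • intVec w‖ ≤
        k * R ^ (4 * k) * δ * ‖intVec w‖ := by
  induction k generalizing g w with
  | zero =>
    rw [pow_zero, Set.mem_one] at hg
    exact ⟨w, by simp [hg]⟩
  | succ k ih =>
    rw [pow_succ'] at hg
    obtain ⟨x, hx, y, hy, rfl⟩ := hg
    obtain ⟨hxb, hxi⟩ := hS x hx
    obtain ⟨v₁, hv₁, hv₁'⟩ := hxi w
    obtain ⟨v, hv⟩ := ih hy v₁
    refine ⟨v, ?_⟩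
    have hR0 : 0 ≤ R := by linarith
    have hsplit : ((x * y : SLR d) : Matrix (Fin d) (Fin d) ℝ).mulVec (intVec v)
          - R ^ (k + 1) • intVec w =
        (x : Matrix (Fin d) (Fin d) ℝ).mulVec
          ((y : Matrix (Fin d) (Fin d) ℝ).mulVec (intVec v) - R ^ k • intVec v₁) +
        R ^ k • ((x : Matrix (Fin d) (Fin d) ℝ).mulVec (intVec v₁) - R • intVec w) := by
      rw [Matrix.mulVec_sub, Matrix.mulVec_smul, Matrix.mulVec_mulVec, smul_sub, smul_smul,
        ← pow_succ, Matrix.SpecialLinearGroup.coe_mul]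
      abel
    have hRk : 0 ≤ R ^ k := pow_nonneg hR0 k
    have h1 : R * R ^ 2 ≤ R ^ 4 := by
      rw [← pow_succ']; exact pow_le_pow_right₀ hR (by norm_num)
    have h2 : R ^ k * R ^ 2 ≤ R ^ (4 * (k + 1)) := by
      rw [← pow_add]; exact pow_le_pow_right₀ hR (by omega)
    have hw := norm_nonneg (intVec w)
    rw [hsplit]
    calc _ ≤ R * (k * R ^ (4 * k) * δ * ‖intVec v₁‖) + R ^ k * (δ * ‖intVec v₁‖) := by
          refine (norm_add_le _ _).trans (add_le_add ((hxb _).trans ?_) ?_)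
          · exact mul_le_mul_of_nonneg_left hv hR0
          · rw [norm_smul, Real.norm_of_nonneg hRk]
            exact mul_le_mul_of_nonneg_left hv₁' hRk
      _ = (R * k * R ^ (4 * k) + R ^ k) * δ * ‖intVec v₁‖ := by ring
      _ ≤ (R * k * R ^ (4 * k) + R ^ k) * δ * (R ^ 2 * ‖intVec w‖) :=
          mul_le_mul_of_nonneg_left hv₁ (by positivity)
      _ = (k * R ^ (4 * k) * (R * R ^ 2) + R ^ k * R ^ 2) * (δ * ‖intVec w‖) := by ring
      _ ≤ (k * R ^ (4 * k) * R ^ 4 + R ^ (4 * (k + 1))) * (δ * ‖intVec w‖) := by gcongr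
      _ = _ := by push_cast; ring

/-- A product `x a y` with `x, y` products of nearly integral matrices and `a` strongly
contracting a basis vector maps some nonzero integer vector to a short one. -/
theorem exists_short_vector (hR : 1 ≤ R) (hδ : 0 ≤ δ) (hS : ∀ g ∈ S, NearIntegral R δ g)
    {a : SLR d} {t : ℝ} (ht : 0 ≤ t) (hat : SupBound t (a : Matrix (Fin d) (Fin d) ℝ)) (i₀ : Fin d)
    (ha : (a : Matrix (Fin d) (Fin d) ℝ).mulVec (Pi.single i₀ 1) = t⁻¹ • Pi.single i₀ 1)
    {m k : ℕ} {x y : SLR d} (hx : x ∈ S ^ m) (hy : y ∈ S ^ k)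
    (hsmall : k * R ^ (4 * k) * δ < 1) :
    ∃ v : Fin d → ℤ, v ≠ 0 ∧
      ‖((x * a * y : SLR d) : Matrix (Fin d) (Fin d) ℝ).mulVec (intVec v)‖ ≤
        R ^ m * (R ^ k * t⁻¹ + t * (k * R ^ (4 * k) * δ)) := by
  have hsingle : intVec (Pi.single i₀ 1 : Fin d → ℤ) = Pi.single i₀ 1 := by
    ext i
    by_cases h : i = i₀
    · subst h; simp [intVec]
    · simp [intVec, h]
  have hnorm : ‖(Pi.single i₀ 1 : Fin d → ℝ)‖ = 1 := by rw [Pi.norm_single, norm_one]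
  have hRk : 0 ≤ R ^ k := by positivity
  obtain ⟨v, hv⟩ := exists_intVec_of_mem_pow hR hδ hS hy (Pi.single i₀ 1)
  rw [hsingle, hnorm, mul_one] at hv
  refine ⟨v, ?_, ?_⟩
  -- If `v` were zero, `R ^ k • e` would be within distance less than `1` of the origin, although `R
  -- ^ k ≥ 1`.
  · rintro rfl
    have h0 : intVec (0 : Fin d → ℤ) = 0 := by ext; simp [intVec]
    rw [h0, Matrix.mulVec_zero, zero_sub, norm_neg, norm_smul, hnorm, mul_one,
      Real.norm_of_nonneg hRk] at hv
    linarith [one_le_pow₀ hR (n := k)]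
  -- The main term is contracted by `t⁻¹`, while the error of `y` is expanded by at most `t`.
  · have hsplit : ((x * a * y : SLR d) : Matrix (Fin d) (Fin d) ℝ).mulVec (intVec v) =
        (x : Matrix (Fin d) (Fin d) ℝ).mulVec (R ^ k • t⁻¹ • Pi.single i₀ 1 +
          (a : Matrix (Fin d) (Fin d) ℝ).mulVec
            ((y : Matrix (Fin d) (Fin d) ℝ).mulVec (intVec v) - R ^ k • Pi.single i₀ 1)) := by
      rw [Matrix.mulVec_sub, Matrix.mulVec_smul, ha, add_sub_cancel, Matrix.mulVec_mulVec,
        Matrix.mulVec_mulVec]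
      simp [mul_assoc]
    rw [hsplit]
    refine (supBound_of_mem_pow hR hS hx _).trans (mul_le_mul_of_nonneg_left ?_ (by positivity))
    refine (norm_add_le _ _).trans (add_le_add ?_ ((hat _).trans ?_))
    · rw [norm_smul, norm_smul, hnorm, mul_one, Real.norm_of_nonneg hRk,
        Real.norm_of_nonneg (inv_nonneg.2 ht)]
    · exact mul_le_mul_of_nonneg_left hv ht

/-- The easy half of Mahler's criterion. -/
theorem exists_systole_bound {K : Set (LatticeSpace d)} (hK : IsCompact K) :
    ∃ r : ℝ, 0 < r ∧ ∀ g ∈ cosetUnion K, ∀ v : Fin d → ℤ, v ≠ 0 →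
      r ≤ ‖(g : Matrix (Fin d) (Fin d) ℝ).mulVec (intVec v)‖ := by
  let f : SLR d → ℝ := fun g => ∑ i, ∑ j, |(g⁻¹ : SLR d) i j|
  have hf : Continuous f := by
    refine continuous_finsetSum _ fun i _ => continuous_finsetSum _ fun j _ => ?_
    have h1 : Continuous fun g : SLR d => ((g⁻¹ : SLR d) : Matrix (Fin d) (Fin d) ℝ) :=
      continuous_subtype_val.comp continuous_inv
    exact (h1.matrix_elem i j).abs
  -- The quotient map is open, so these images form an increasing open cover; compactness gives
  -- every coset in `K` a representative whose inverse is bounded by one constant.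
  let U : ℕ → Set (LatticeSpace d) := fun n => QuotientGroup.mk '' {g | f g < n}
  have hU : ∀ n, IsOpen (U n) := fun n =>
    QuotientGroup.isOpenMap_coe _ (isOpen_lt hf continuous_const)
  have hmono : Monotone U := fun m n hmn => Set.image_mono fun g (hg : f g < m) =>
    lt_of_lt_of_le hg (Nat.cast_le.2 hmn)
  have hcov : K ⊆ ⋃ n, U n := by
    intro x _
    obtain ⟨g, rfl⟩ := QuotientGroup.mk_surjective x
    obtain ⟨n, hn⟩ := exists_nat_gt (f g)
    exact Set.mem_iUnion.2 ⟨n, g, hn, rfl⟩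
  obtain ⟨n, hn⟩ := hK.elim_directed_cover U hU hcov hmono.directed_le
  refine ⟨((n : ℝ) + 1)⁻¹, by positivity, fun g hg v hv => ?_⟩
  obtain ⟨g₀, hg₀, hgg⟩ := hn hg
  obtain ⟨γ, hγ⟩ := QuotientGroup.eq.1 hgg
  have hg' : g = g₀ * Matrix.SpecialLinearGroup.map (Int.castRingHom ℝ) γ := by
    have : g₀⁻¹ * g = Matrix.SpecialLinearGroup.map (Int.castRingHom ℝ) γ := hγ.symm
    rw [← this, mul_inv_cancel_left]
  -- Changing representative replaces `v` by another nonzero integer vector, still of norm at least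
  -- `1`.
  have hw : (γ : Matrix (Fin d) (Fin d) ℤ).mulVec v ≠ 0 := by
    intro h0
    apply hv
    have : ((γ⁻¹ * γ : Matrix.SpecialLinearGroup (Fin d) ℤ) : Matrix (Fin d) (Fin d) ℤ).mulVec v
        = 0 := by
      rw [Matrix.SpecialLinearGroup.coe_mul, ← Matrix.mulVec_mulVec, h0, Matrix.mulVec_zero]
    simpa using this
  have hgv : (g : Matrix (Fin d) (Fin d) ℝ).mulVec (intVec v) =
      (g₀ : Matrix (Fin d) (Fin d) ℝ).mulVec
        (intVec ((γ : Matrix (Fin d) (Fin d) ℤ).mulVec v)) := by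
    rw [hg', Matrix.SpecialLinearGroup.coe_mul, ← Matrix.mulVec_mulVec, ← intVec_mulVec]
    rfl
  have hinv : intVec ((γ : Matrix (Fin d) (Fin d) ℤ).mulVec v) =
      ((g₀⁻¹ : SLR d) : Matrix (Fin d) (Fin d) ℝ).mulVec
        ((g : Matrix (Fin d) (Fin d) ℝ).mulVec (intVec v)) := by
    rw [hgv, Matrix.mulVec_mulVec, ← Matrix.SpecialLinearGroup.coe_mul]
    simp
  have h1 := one_le_norm_intVec hw
  rw [hinv] at h1
  have h2 := h1.trans (supBound_sum_abs _ _)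
  have h3 : f g₀ * ‖(g : Matrix (Fin d) (Fin d) ℝ).mulVec (intVec v)‖ ≤
      (n + 1) * ‖(g : Matrix (Fin d) (Fin d) ℝ).mulVec (intVec v)‖ :=
    mul_le_mul_of_nonneg_right (by linarith [show f g₀ < n from hg₀]) (norm_nonneg _)
  rw [inv_le_iff_one_le_mul₀ (by positivity), mul_comm]
  exact h2.trans h3

end Lattice

/-! ### Euclidean operator norm versus sup-norm bounds. -/

section OpNorm

variable {d : ℕ}

theorem opNorm_le_of_supBound {c : ℝ} (hc : 0 ≤ c) {g : SLR d}
    (h : SupBound c (g : Matrix (Fin d) (Fin d) ℝ)) : opNorm g ≤ d * c := by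
  refine ContinuousLinearMap.opNorm_le_bound _ (by positivity) fun x => ?_
  have hx : ‖(x.ofLp : Fin d → ℝ)‖ ≤ ‖x‖ :=
    (pi_norm_le_iff_of_nonneg (norm_nonneg x)).2 fun i => PiLp.norm_apply_le x i
  have hy : ∀ i, ‖(Matrix.toEuclideanCLM (n := Fin d) (𝕜 := ℝ)
      (g : Matrix (Fin d) (Fin d) ℝ) x) i‖ ≤ c * ‖x‖ := fun i =>
    (norm_le_pi_norm ((g : Matrix (Fin d) (Fin d) ℝ).mulVec x.ofLp) i).trans
      ((h _).trans (mul_le_mul_of_nonneg_left hx hc))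
  rw [EuclideanSpace.norm_eq]
  refine Real.sqrt_le_iff.2 ⟨by positivity, ?_⟩
  calc _ ≤ ∑ _i : Fin d, (c * ‖x‖) ^ 2 :=
        Finset.sum_le_sum fun i _ => pow_le_pow_left₀ (norm_nonneg _) (hy i) 2
    _ = d * (c * ‖x‖) ^ 2 := by simp
    _ ≤ (d : ℝ) ^ 2 * (c * ‖x‖) ^ 2 := by
        refine mul_le_mul_of_nonneg_right ?_ (by positivity)
        exact_mod_cast Nat.le_self_pow two_ne_zero d
    _ = _ := by ring

theorem opNorm_mul_le (g h : SLR d) : opNorm (g * h) ≤ opNorm g * opNorm h := by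
  unfold opNorm
  rw [Matrix.SpecialLinearGroup.coe_mul, map_mul]
  exact norm_mul_le _ _

theorem opNorm_one (hd : 0 < d) : opNorm (1 : SLR d) = 1 := by
  have : Nonempty (Fin d) := ⟨⟨0, hd⟩⟩
  unfold opNorm
  rw [Matrix.SpecialLinearGroup.coe_one, map_one, norm_one]

/-- The lower bound on `log ‖g‖` comes from `1 ≤ ‖g‖ ‖g⁻¹‖`, so no use is made of `‖g‖ ≥ 1`. -/
theorem abs_log_opNorm_le (hd : 0 < d) {c : ℝ} (hc : 1 ≤ c) {g : SLR d}
    (h : SupBound c (g : Matrix (Fin d) (Fin d) ℝ))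
    (h' : SupBound c ((g⁻¹ : SLR d) : Matrix (Fin d) (Fin d) ℝ)) :
    |Real.log (opNorm g)| ≤ Real.log (d * c) := by
  have h1 := opNorm_le_of_supBound (by linarith) h
  have h2 := opNorm_le_of_supBound (by linarith) h'
  have h3 : 1 ≤ opNorm g * opNorm g⁻¹ := by
    rw [← opNorm_one hd, ← mul_inv_cancel g]
    exact opNorm_mul_le _ _
  have hg0 : 0 ≤ opNorm g := norm_nonneg _
  have hg0' : 0 ≤ opNorm g⁻¹ := norm_nonneg _
  have hg : 0 < opNorm g := by
    rcases hg0.eq_or_lt with h | h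
    · rw [← h] at h3; norm_num at h3
    · exact h
  have hdc : 0 < (d : ℝ) * c := by positivity
  rw [abs_le]
  constructor
  · rw [← Real.log_inv]
    refine Real.log_le_log (by positivity) ?_
    rw [inv_le_iff_one_le_mul₀ hdc]
    exact h3.trans (mul_le_mul_of_nonneg_left h2 hg0)
  · exact Real.log_le_log hg h1

end OpNorm

/-! ### Elementary shears. -/

section Shear

open Matrix.SpecialLinearGroup

variable {d : ℕ} {i j : Fin d} (hij : i ≠ j)

theorem transvection_mulVec (s : ℝ) (v : Fin d → ℝ) :
    (transvection hij s : Matrix (Fin d) (Fin d) ℝ).mulVec v = v + Pi.single i (s * v j) := by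
  rw [transvection_coe, Matrix.add_mulVec, Matrix.one_mulVec]
  congr 1
  ext k
  by_cases hk : k = i
  · subst hk; simp [Matrix.mulVec, dotProduct, Matrix.single_apply]
  · simp [Matrix.mulVec, dotProduct, hk, Ne.symm hk]

theorem continuous_transvection : Continuous fun s : ℝ => (transvection hij s : SLR d) := by
  refine Continuous.subtype_mk ?_ _
  unfold Matrix.transvection
  refine continuous_const.add (continuous_matrix fun k l => ?_)
  simp only [Matrix.single_apply]
  split_ifs <;> fun_prop

theorem transvection_injective :
    Function.Injective fun s : ℝ => (transvection hij s : SLR d) := fun s t hst => by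
  have h : (transvection hij s : Matrix (Fin d) (Fin d) ℝ) i j =
      (transvection hij t : Matrix (Fin d) (Fin d) ℝ) i j := congrArg (fun g : SLR d => g i j) hst
  simpa [transvection_coe, hij] using h

theorem supBound_transvection {s c : ℝ} (hs : |s| ≤ c) :
    SupBound (1 + c) (transvection hij s : Matrix (Fin d) (Fin d) ℝ) := fun v => by
  rw [transvection_mulVec, add_mul, one_mul]
  refine (norm_add_le _ _).trans (add_le_add le_rfl ?_)
  rw [Pi.norm_single, norm_mul, Real.norm_eq_abs]
  exact mul_le_mul hs (norm_le_pi_norm v j) (norm_nonneg _) ((abs_nonneg s).trans hs)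

/-- A shear is nearly integral if its parameter is close to a rational number
of denominator dividing `R`. -/
theorem nearIntegral_transvection {R : ℕ} (hR : 3 ≤ R) {s s' δ : ℝ} (hs : |s| ≤ 2)
    (hs' : |s'| ≤ 2) (hss : |s - s'| ≤ δ) (z : ℤ) (hz : (R : ℝ) * s' = z) :
    NearIntegral R δ (transvection hij s : SLR d) := by
  have hR' : (3 : ℝ) ≤ R := by exact_mod_cast hR
  refine ⟨(supBound_transvection hij hs).mono (by linarith), fun w => ?_⟩
  -- The preimage of `R w` under the shear of parameter `s'`; it is integral because `R s' = z`.
  -- Replacing `s'` by `s` then costs only `δ`.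
  have hv : intVec ((R : ℤ) • w - Pi.single i (z * w j)) =
      (R : ℝ) • (transvection hij (-s') : Matrix (Fin d) (Fin d) ℝ).mulVec (intVec w) := by
    rw [transvection_mulVec]
    ext k
    by_cases hk : k = i
    · subst hk; simp [intVec, ← hz]; ring
    · simp [intVec, hk]
  refine ⟨(R : ℤ) • w - Pi.single i (z * w j), ?_, ?_⟩
  · have hb := supBound_transvection hij (s := -s') (c := 2) (by rwa [abs_neg]) (intVec w)
    rw [hv, norm_smul, Real.norm_of_nonneg (by linarith)]
    calc (R : ℝ) * _ ≤ R * ((1 + 2) * ‖intVec w‖) := mul_le_mul_of_nonneg_left hb (by linarith)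
      _ ≤ R * (R * ‖intVec w‖) := by gcongr; linarith
      _ = _ := by ring
  · have hRw : (R : ℝ) • intVec w = (transvection hij s' : Matrix (Fin d) (Fin d) ℝ).mulVec
        (intVec ((R : ℤ) • w - Pi.single i (z * w j))) := by
      rw [hv, Matrix.mulVec_smul, Matrix.mulVec_mulVec, ← coe_mul, transvection_mul_neg, coe_one,
        Matrix.one_mulVec]
    rw [hRw, transvection_mulVec, transvection_mulVec, add_sub_add_left_eq_sub, ← Pi.single_sub,
      ← sub_mul, Pi.norm_single, norm_mul, Real.norm_eq_abs]
    exact mul_le_mul hss (norm_le_pi_norm _ j) (norm_nonneg _) ((abs_nonneg _).trans hss)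

end Shear

/-! ### Rational matrices: near integrality, density and the stretch. -/

section Rational

variable {d : ℕ}

/-- The inclusion of `SL_d(ℚ)` in `SL_d(ℝ)`. -/
noncomputable def ratSL (d : ℕ) : Matrix.SpecialLinearGroup (Fin d) ℚ →* SLR d :=
  Matrix.SpecialLinearGroup.map (Rat.castHom ℝ)

theorem ratSL_apply (q : Matrix.SpecialLinearGroup (Fin d) ℚ) (i j : Fin d) :
    (ratSL d q : Matrix (Fin d) (Fin d) ℝ) i j = (q i j : ℚ) := rfl

theorem coe_ratSL_mk (A : Matrix (Fin d) (Fin d) ℚ) (hA : A.det = 1) :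
    (ratSL d ⟨A, hA⟩ : Matrix (Fin d) (Fin d) ℝ) = A.map (Rat.castHom ℝ) := rfl

theorem exists_supBound (g : SLR d) :
    ∃ n : ℕ, 1 ≤ n ∧ SupBound n (g : Matrix (Fin d) (Fin d) ℝ) ∧
      SupBound n ((g⁻¹ : SLR d) : Matrix (Fin d) (Fin d) ℝ) := by
  obtain ⟨n, hn⟩ := exists_nat_ge (∑ i, ∑ j, |g i j|)
  obtain ⟨m, hm⟩ := exists_nat_ge (∑ i, ∑ j, |(g⁻¹ : SLR d) i j|)
  refine ⟨n + m + 1, by omega, (supBound_sum_abs _).mono ?_, (supBound_sum_abs _).mono ?_⟩ <;>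
  · push_cast
    linarith [n.cast_nonneg (α := ℝ), m.cast_nonneg (α := ℝ)]

theorem exists_den (q : Matrix.SpecialLinearGroup (Fin d) ℚ) :
    ∃ n : ℕ, 1 ≤ n ∧ ∀ R : ℕ, n ∣ R → ∃ Z : Matrix (Fin d) (Fin d) ℤ,
      (R : ℝ) • (ratSL d q : Matrix (Fin d) (Fin d) ℝ) = Z.map (Int.cast : ℤ → ℝ) := by
  refine ⟨∏ x : Fin d × Fin d, (q x.1 x.2).den,
    Finset.prod_pos fun (x : Fin d × Fin d) _ => (q x.1 x.2).den_pos, fun R hR => ?_⟩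
  have hdiv : ∀ i j, (q i j).den ∣ R := fun i j =>
    (Finset.dvd_prod_of_mem (fun x : Fin d × Fin d => (q x.1 x.2).den)
      (Finset.mem_univ (i, j))).trans hR
  choose c hc using hdiv
  refine ⟨Matrix.of fun i j => c i j * (q i j).num, ?_⟩
  ext i j
  rw [Matrix.smul_apply, ratSL_apply, Matrix.map_apply, Matrix.of_apply, smul_eq_mul]
  have h1 : (R : ℝ) = (q i j).den * c i j := by exact_mod_cast hc i j
  have h2 : ((q i j : ℚ) : ℝ) * (q i j).den = (q i j).num := by exact_mod_cast Rat.mul_den_eq_num _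
  rw [h1]
  push_cast
  linear_combination (c i j : ℝ) * h2

/-- The vector `R q⁻¹ w` is integral once `R` clears the denominators of `q⁻¹`, and `q` maps it to
`R w` with no error; hence any `δ ≥ 0` is allowed. -/
theorem exists_nearIntegral_ratSL (q : Matrix.SpecialLinearGroup (Fin d) ℚ) :
    ∃ n : ℕ, 1 ≤ n ∧ ∀ R : ℕ, n ∣ R → 1 ≤ R → ∀ δ : ℝ, 0 ≤ δ → NearIntegral R δ (ratSL d q) := by
  obtain ⟨n, hn1, hn, hn'⟩ := exists_supBound (ratSL d q)
  obtain ⟨m, hm1, hm⟩ := exists_den q⁻¹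
  refine ⟨n * m, Nat.mul_pos hn1 hm1, fun R hR hR1 δ hδ => ?_⟩
  have hnR : (n : ℝ) ≤ R := by
    exact_mod_cast Nat.le_of_dvd hR1 ((dvd_mul_right n m).trans hR)
  obtain ⟨Z, hZ⟩ := hm R ((dvd_mul_left m n).trans hR)
  refine ⟨hn.mono hnR, fun w => ?_⟩
  have hv : intVec (Z.mulVec w) =
      (R : ℝ) • ((ratSL d q⁻¹ : SLR d) : Matrix (Fin d) (Fin d) ℝ).mulVec (intVec w) := by
    rw [← intVec_mulVec, ← hZ, Matrix.smul_mulVec]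
  refine ⟨Z.mulVec w, ?_, ?_⟩
  · have hb := (hn'.mono hnR) (intVec w)
    rw [← map_inv] at hb
    rw [hv, norm_smul, Real.norm_of_nonneg (by positivity), sq, mul_assoc]
    exact mul_le_mul_of_nonneg_left hb (by positivity)
  · rw [hv, Matrix.mulVec_smul, Matrix.mulVec_mulVec, ← Matrix.SpecialLinearGroup.coe_mul,
      ← map_mul, mul_inv_cancel, map_one, Matrix.SpecialLinearGroup.coe_one, Matrix.one_mulVec,
      sub_self, norm_zero]
    positivity

theorem exists_nearIntegral_ratSL_inv (q : Matrix.SpecialLinearGroup (Fin d) ℚ) :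
    ∃ n : ℕ, 1 ≤ n ∧ ∀ R : ℕ, n ∣ R → 1 ≤ R → ∀ δ : ℝ, 0 ≤ δ →
      NearIntegral R δ (ratSL d q) ∧ NearIntegral R δ (ratSL d q)⁻¹ := by
  obtain ⟨n, hn1, hn⟩ := exists_nearIntegral_ratSL q
  obtain ⟨m, hm1, hm⟩ := exists_nearIntegral_ratSL q⁻¹
  refine ⟨n * m, Nat.mul_pos hn1 hm1, fun R hR hR1 δ hδ =>
    ⟨hn R ((dvd_mul_right n m).trans hR) hR1 δ hδ, ?_⟩⟩
  rw [← map_inv]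
  exact hm R ((dvd_mul_left m n).trans hR) hR1 δ hδ

/-- Approximate the entries by rationals, then divide one row by the determinant. This normalization
is continuous near `g`, fixes `g`, and preserves rationality. -/
theorem denseRange_ratSL (hd : 0 < d) : DenseRange (ratSL d) := by
  intro g
  rw [mem_closure_iff]
  rintro U hU hgU
  obtain ⟨V, hV, rfl⟩ := isOpen_induced_iff.1 hU
  let i : Fin d := ⟨0, hd⟩
  let Φ : Matrix (Fin d) (Fin d) ℝ → Matrix (Fin d) (Fin d) ℝ :=
    fun M => M.updateRow i (M.det⁻¹ • M i)
  have hdet : Continuous fun M : Matrix (Fin d) (Fin d) ℝ => M.det := continuous_id.matrix_det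
  have hg1 : (g : Matrix (Fin d) (Fin d) ℝ).det = 1 := g.2
  have hΦ : ContinuousAt Φ (g : Matrix (Fin d) (Fin d) ℝ) := by
    have h1 : ContinuousAt (fun M : Matrix (Fin d) (Fin d) ℝ => M.det⁻¹)
        (g : Matrix (Fin d) (Fin d) ℝ) :=
      hdet.continuousAt.inv₀ (by rw [hg1]; exact one_ne_zero)
    have h2 : ContinuousAt (fun M : Matrix (Fin d) (Fin d) ℝ => M i)
        (g : Matrix (Fin d) (Fin d) ℝ) := (continuous_apply i).continuousAt
    have h3 : ContinuousAt (fun M : Matrix (Fin d) (Fin d) ℝ => M.det⁻¹ • M i)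
        (g : Matrix (Fin d) (Fin d) ℝ) := Filter.Tendsto.smul h1 h2
    exact ContinuousAt.update continuousAt_id i h3
  have hΦg : Φ g = g := by simp [Φ, hg1]
  have hnhds : {M | Φ M ∈ V ∧ M.det ≠ 0} ∈ 𝓝 (g : Matrix (Fin d) (Fin d) ℝ) := by
    have hV' : V ∈ 𝓝 (Φ g) := hV.mem_nhds (by rw [hΦg]; exact hgU)
    have h0 : (g : Matrix (Fin d) (Fin d) ℝ).det ≠ 0 := by rw [hg1]; exact one_ne_zero
    exact (hΦ.eventually hV').and (hdet.continuousAt.eventually (isOpen_ne.mem_nhds h0))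
  have hdense : DenseRange
      fun M : Matrix (Fin d) (Fin d) ℚ => (Rat.castHom ℝ).mapMatrix M :=
    DenseRange.piMap fun _ : Fin d => DenseRange.piMap fun _ : Fin d => Rat.denseRange_cast (𝕜 := ℝ)
  obtain ⟨_, ⟨hMV, hM0⟩, M, rfl⟩ := mem_closure_iff_nhds.1
    (hdense (g : Matrix (Fin d) (Fin d) ℝ)) _ hnhds
  have hcd := RingHom.map_det (Rat.castHom ℝ) M
  simp only [Φ] at hMV
  rw [← hcd] at hM0 hMV
  have hM0' : M.det ≠ 0 := fun h => hM0 (by rw [h, map_zero])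
  have hdetM : (M.updateRow i (M.det⁻¹ • M i)).det = 1 := by
    rw [Matrix.det_updateRow_smul, Matrix.updateRow_eq_self, inv_mul_cancel₀ hM0']
  refine ⟨ratSL d ⟨M.updateRow i (M.det⁻¹ • M i), hdetM⟩, ?_, ⟨_, rfl⟩⟩
  change (M.updateRow i (M.det⁻¹ • M i)).map (Rat.castHom ℝ) ∈ V
  convert hMV using 1
  ext k l
  by_cases hk : k = i
  · subst hk; simp
  · simp [Matrix.updateRow_ne hk]

theorem exists_stretch {i j : Fin d} (hij : i ≠ j) (t : ℕ) :
    ∃ a : Matrix.SpecialLinearGroup (Fin d) ℚ, 1 ≤ t →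
      SupBound t (ratSL d a : Matrix (Fin d) (Fin d) ℝ) ∧
      SupBound t (((ratSL d a)⁻¹ : SLR d) : Matrix (Fin d) (Fin d) ℝ) ∧
      (ratSL d a : Matrix (Fin d) (Fin d) ℝ).mulVec (Pi.single i 1) =
        (t : ℝ)⁻¹ • Pi.single i 1 := by
  -- The value at `t = 0` is a dummy that makes the stretch a total function of `t`.
  rcases Nat.eq_zero_or_pos t with rfl | ht
  · exact ⟨1, fun h => absurd h (by norm_num)⟩
  have ht0 : (t : ℚ) ≠ 0 := by positivity
  have ht1 : (1 : ℝ) ≤ t := by exact_mod_cast ht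
  have hprod : ∀ x : ℚ, x ≠ 0 →
      ∏ k, Function.update (Function.update (1 : Fin d → ℚ) i x⁻¹) j x k = 1 := fun x hx => by
    rw [Finset.prod_update_of_mem (Finset.mem_univ j), Finset.prod_update_of_mem (by simp [hij])]
    simp [hx]
  let a : Matrix.SpecialLinearGroup (Fin d) ℚ :=
    ⟨Matrix.diagonal (Function.update (Function.update 1 i (t : ℚ)⁻¹) j t), by
      rw [Matrix.det_diagonal, hprod _ ht0]⟩
  let b : Matrix.SpecialLinearGroup (Fin d) ℚ :=
    ⟨Matrix.diagonal (Function.update (Function.update 1 i ((t : ℚ)⁻¹)⁻¹) j (t : ℚ)⁻¹), by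
      rw [Matrix.det_diagonal, hprod _ (inv_ne_zero ht0)]⟩
  have hab : a * b = 1 := by
    refine Subtype.ext ((Matrix.diagonal_mul_diagonal _ _).trans ?_)
    rw [Matrix.SpecialLinearGroup.coe_one, ← Matrix.diagonal_one]
    congr 1
    ext k
    by_cases hk : k = j
    · subst hk; simp [ht0]
    · by_cases hk' : k = i
      · subst hk'; simp [hk, ht0]
      · simp [hk, hk']
  have hb : a⁻¹ = b := inv_eq_of_mul_eq_one_right hab
  have hdiag : ∀ (f : Fin d → ℚ) (hf : (Matrix.diagonal f).det = 1) (v : Fin d → ℝ) (k : Fin d),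
      (ratSL d ⟨Matrix.diagonal f, hf⟩ : Matrix (Fin d) (Fin d) ℝ).mulVec v k = f k * v k := by
    intro f hf v k
    rw [coe_ratSL_mk, Matrix.diagonal_map (map_zero _), Matrix.mulVec_diagonal]
    rfl
  have hbound : ∀ (f : Fin d → ℚ) (hf : (Matrix.diagonal f).det = 1),
      (∀ k, |(f k : ℝ)| ≤ t) →
      SupBound t (ratSL d ⟨Matrix.diagonal f, hf⟩ : Matrix (Fin d) (Fin d) ℝ) := by
    intro f hf hft v
    rw [pi_norm_le_iff_of_nonneg (by positivity)]
    intro k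
    rw [hdiag, norm_mul, Real.norm_eq_abs]
    exact mul_le_mul (hft k) (norm_le_pi_norm v k) (norm_nonneg _) (by linarith)
  have hti : (t : ℝ)⁻¹ ≤ t := (inv_le_one_of_one_le₀ ht1).trans ht1
  refine ⟨a, fun _ => ⟨hbound _ _ fun k => ?_, ?_, ?_⟩⟩
  · by_cases hk : k = j
    · subst hk; simp
    · by_cases hk' : k = i
      · subst hk'; simpa [hk] using hti
      · simpa [hk, hk'] using ht1
  · rw [← map_inv, hb]
    refine hbound _ _ fun k => ?_
    by_cases hk : k = j
    · subst hk; simpa using hti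
    · by_cases hk' : k = i
      · subst hk'; simp [hk]
      · simpa [hk, hk'] using ht1
  · ext k
    rw [hdiag]
    by_cases hk : k = i
    · subst hk; simp [hij]
    · simp [hk]

end Rational

/-! ### A non-atomic law on lacunary sums of unit fractions. -/

section Noise

variable {E : ℕ → ℕ}

/-- The real number `∑ 1 / E n` over the `n` with `x n = true`. -/
noncomputable def lacunarySum (E : ℕ → ℕ) (x : ℕ → Bool) : ℝ :=
  ∑' n, if x n then ((E n : ℝ))⁻¹ else 0

theorem inv_add_le_geometric (hE0 : ∀ n, 1 ≤ E n) (hE : ∀ n, 3 * E n ≤ E (n + 1)) (J n : ℕ) :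
    ((E (J + n) : ℝ))⁻¹ ≤ ((E J : ℝ))⁻¹ * (1 / 3) ^ n := by
  induction n with
  | zero => simp
  | succ n ih =>
    have h0 : (0 : ℝ) < E (J + n) := by exact_mod_cast hE0 _
    have h1 : (3 : ℝ) * E (J + n) ≤ E (J + (n + 1)) := by exact_mod_cast hE (J + n)
    calc ((E (J + (n + 1)) : ℝ))⁻¹ ≤ (3 * (E (J + n) : ℝ))⁻¹ := inv_anti₀ (by positivity) h1
      _ = ((E (J + n) : ℝ))⁻¹ * (1 / 3) := by rw [mul_inv]; ring
      _ ≤ ((E J : ℝ))⁻¹ * (1 / 3) ^ n * (1 / 3) := by gcongr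
      _ = _ := by ring

theorem ite_inv_nonneg (x : ℕ → Bool) (n : ℕ) : 0 ≤ if x n then ((E n : ℝ))⁻¹ else 0 := by
  split_ifs <;> positivity

theorem ite_inv_le (x : ℕ → Bool) (n : ℕ) :
    (if x n then ((E n : ℝ))⁻¹ else 0) ≤ ((E n : ℝ))⁻¹ := by
  split_ifs
  · exact le_rfl
  · positivity

theorem summable_inv (hE0 : ∀ n, 1 ≤ E n) (hE : ∀ n, 3 * E n ≤ E (n + 1)) :
    Summable fun n => ((E n : ℝ))⁻¹ := by
  refine Summable.of_nonneg_of_le (fun n => by positivity) (fun n => ?_)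
    ((summable_geometric_of_lt_one (r := (1 / 3 : ℝ)) (by norm_num) (by norm_num)).mul_left
      ((E 0 : ℝ))⁻¹)
  simpa using inv_add_le_geometric hE0 hE 0 n

theorem summable_ite_inv (hE0 : ∀ n, 1 ≤ E n) (hE : ∀ n, 3 * E n ≤ E (n + 1)) (x : ℕ → Bool) :
    Summable fun n => if x n then ((E n : ℝ))⁻¹ else 0 :=
  Summable.of_nonneg_of_le (ite_inv_nonneg x) (ite_inv_le x) (summable_inv hE0 hE)

theorem lacunarySum_sub_sum_nonneg (hE0 : ∀ n, 1 ≤ E n) (hE : ∀ n, 3 * E n ≤ E (n + 1))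
    (x : ℕ → Bool) (J : ℕ) :
    ∑ n ∈ Finset.range J, (if x n then ((E n : ℝ))⁻¹ else 0) ≤ lacunarySum E x :=
  (summable_ite_inv hE0 hE x).sum_le_tsum _ fun n _ => ite_inv_nonneg x n

theorem lacunarySum_le (hE0 : ∀ n, 1 ≤ E n) (hE : ∀ n, 3 * E n ≤ E (n + 1))
    (x : ℕ → Bool) (J : ℕ) :
    lacunarySum E x ≤ ∑ n ∈ Finset.range J, (if x n then ((E n : ℝ))⁻¹ else 0) +
      ((E J : ℝ))⁻¹ * (3 / 2) := by
  have hs := summable_ite_inv hE0 hE x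
  rw [lacunarySum, ← hs.sum_add_tsum_nat_add J]
  refine add_le_add le_rfl ?_
  have hgeo : HasSum (fun n => ((E J : ℝ))⁻¹ * (1 / 3) ^ n) (((E J : ℝ))⁻¹ * (3 / 2)) := by
    have := (hasSum_geometric_of_lt_one (r := (1 / 3 : ℝ)) (by norm_num) (by norm_num)).mul_left
      ((E J : ℝ))⁻¹
    rwa [show (1 - 1 / 3 : ℝ)⁻¹ = 3 / 2 by norm_num] at this
  rw [← hgeo.tsum_eq]
  refine Summable.tsum_le_tsum (fun n => ?_) ((summable_nat_add_iff J).2 hs) hgeo.summable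
  refine (ite_inv_le x _).trans ?_
  rw [add_comm n J]
  exact inv_add_le_geometric hE0 hE J n

theorem continuous_lacunarySum (hE0 : ∀ n, 1 ≤ E n) (hE : ∀ n, 3 * E n ≤ E (n + 1)) :
    Continuous (lacunarySum E) := by
  refine continuous_tsum (fun n => ?_) (summable_inv hE0 hE) fun n x => ?_
  · exact (continuous_of_discreteTopology (f := fun b : Bool => if b then ((E n : ℝ))⁻¹ else 0)).comp
      (continuous_apply n)
  · rw [Real.norm_of_nonneg (ite_inv_nonneg x n)]
    exact ite_inv_le x n

/-- At the first index `n` where two sequences differ, the term `1 / E n` beats everything after it: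
the tail is at most `(3 / 2) / E (n + 1) ≤ (1 / 2) / E n`. -/
theorem lacunarySum_injective (hE0 : ∀ n, 1 ≤ E n) (hE : ∀ n, 3 * E n ≤ E (n + 1)) :
    Function.Injective (lacunarySum E) := by
  have key : ∀ x y : ℕ → Bool, ∀ n, (∀ m < n, x m = y m) → x n = true → y n = false →
      lacunarySum E y < lacunarySum E x := by
    intro x y n hlt hx hy
    have h1 := lacunarySum_sub_sum_nonneg hE0 hE x (n + 1)
    have h2 := lacunarySum_le hE0 hE y (n + 1)
    have h3 : ∑ m ∈ Finset.range n, (if x m then ((E m : ℝ))⁻¹ else 0) =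
        ∑ m ∈ Finset.range n, (if y m then ((E m : ℝ))⁻¹ else 0) :=
      Finset.sum_congr rfl fun m hm => by rw [hlt m (Finset.mem_range.1 hm)]
    have h4 := inv_add_le_geometric hE0 hE n 1
    have h5 : (0 : ℝ) < ((E n : ℝ))⁻¹ := inv_pos.2 (by exact_mod_cast hE0 n)
    rw [Finset.sum_range_succ] at h1 h2
    simp only [hx, hy, if_true, Bool.false_eq_true, if_false, add_zero] at h1 h2
    norm_num at h4
    linarith
  intro x y hxy
  by_contra hne
  have hex : ∃ n, x n ≠ y n := Function.ne_iff.1 hne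
  classical
  have hmin : ∀ m < Nat.find hex, x m = y m := fun m hm => not_not.1 (Nat.find_min hex hm)
  have hfind := Nat.find_spec hex
  rcases hxn : x (Nat.find hex) with _ | _
  · rw [hxn] at hfind
    exact (key y x _ (fun m hm => (hmin m hm).symm) (by simpa using hfind.symm) hxn).ne hxy
  · rw [hxn] at hfind
    exact (key x y _ hmin hxn (by simpa using hfind.symm)).ne' hxy

theorem exists_noise_measure (hE0 : ∀ n, 1 ≤ E n) (hE : ∀ n, 3 * E n ≤ E (n + 1)) :
    ∃ κ : Measure ℝ, IsProbabilityMeasure κ ∧ (∀ s, κ {s} = 0) ∧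
      κ (Set.range (lacunarySum E))ᶜ = 0 := by
  have hunc : ¬ Countable unitInterval := by
    intro h
    have h1 : (volume : Measure unitInterval) Set.univ = 0 :=
      (Set.countable_univ (α := unitInterval)).measure_zero _
    simp at h1
  -- A Borel isomorphism from the unit interval to Cantor space transports the non-atomic Lebesgue
  -- measure; injectivity of `lacunarySum` keeps it non-atomic.
  let e := PolishSpace.measurableEquivNatBoolOfNotCountable hunc
  have hmeas : Measurable (lacunarySum E ∘ e) :=
    (continuous_lacunarySum hE0 hE).measurable.comp e.measurable
  refine ⟨Measure.map (lacunarySum E ∘ e) volume, Measure.isProbabilityMeasure_map hmeas.aemeasurable,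
    fun s => ?_, ?_⟩
  · rw [Measure.map_apply hmeas (measurableSet_singleton s)]
    have hsub : ((lacunarySum E ∘ e) ⁻¹' {s}).Subsingleton := fun a ha b hb =>
      ((lacunarySum_injective hE0 hE).comp e.injective) (ha.trans hb.symm)
    exact hsub.measure_zero _
  · have hc : IsCompact (Set.range (lacunarySum E)) :=
      isCompact_range (continuous_lacunarySum hE0 hE)
    rw [Measure.map_apply hmeas hc.measurableSet.compl]
    convert measure_empty (μ := (volume : Measure unitInterval))
    ext a
    simp

/-- The truncations of a lacunary sum have bounded denominators. -/
theorem exists_approx_lacunarySum (hE0 : ∀ n, 1 ≤ E n) (hE : ∀ n, 3 * E n ≤ E (n + 1))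
    (x : ℕ → Bool) {R J : ℕ} (hR : ∀ n < J, E n ∣ R) :
    |lacunarySum E x| ≤ 2 ∧ ∃ s' : ℝ, |s'| ≤ 2 ∧ |lacunarySum E x - s'| ≤ 2 * ((E J : ℝ))⁻¹ ∧
      ∃ z : ℤ, (R : ℝ) * s' = z := by
  have h0 := lacunarySum_sub_sum_nonneg hE0 hE x 0
  have h1 := lacunarySum_le hE0 hE x 0
  have h2 := lacunarySum_sub_sum_nonneg hE0 hE x J
  have h3 := lacunarySum_le hE0 hE x J
  have h4 : 0 ≤ ∑ n ∈ Finset.range J, (if x n then ((E n : ℝ))⁻¹ else 0) :=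
    Finset.sum_nonneg fun n _ => ite_inv_nonneg x n
  have h5 : ((E 0 : ℝ))⁻¹ ≤ 1 := inv_le_one_of_one_le₀ (by exact_mod_cast hE0 0)
  have h6 : (0 : ℝ) ≤ ((E J : ℝ))⁻¹ := by positivity
  simp only [Finset.range_zero, Finset.sum_empty, zero_add] at h0 h1
  refine ⟨abs_le.2 ⟨by linarith, by linarith⟩,
    ∑ n ∈ Finset.range J, (if x n then ((E n : ℝ))⁻¹ else 0), abs_le.2 ⟨by linarith, by linarith⟩,
    abs_le.2 ⟨by linarith, by linarith⟩,
    ∑ n ∈ Finset.range J, (if x n then ((R / E n : ℕ) : ℤ) else 0), ?_⟩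
  rw [Finset.mul_sum, Int.cast_sum]
  refine Finset.sum_congr rfl fun n hn => ?_
  split_ifs
  · have h7 : (E n : ℝ) ≠ 0 := by exact_mod_cast (Nat.one_le_iff_ne_zero.1 (hE0 n))
    rw [Int.cast_natCast, Nat.cast_div (hR n (Finset.mem_range.1 hn)) h7, div_eq_mul_inv]
  · simp

end Noise

/-! ### Recursive choice of the scales. -/

section Parameters

/-- The logarithm is at most `b N` with `b` independent of `N`, and `(b N) ^ p = o(N)`. This is
where `p < 1` enters. -/
theorem exists_rpow_log_le {p : ℝ} (hp0 : 0 < p) (hp1 : p < 1) (A R N₀ : ℕ) (hA : 1 ≤ A)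
    (hR : 1 ≤ R) (J : ℕ) : ∃ N : ℕ, N₀ ≤ N ∧ 1 ≤ N ∧
      Real.log (A * (R : ℝ) ^ (4 * N + 1)) ^ p ≤ N * (1 / 2) ^ J := by
  set b : ℝ := Real.log A + 5 * Real.log R with hb
  have hA' : (1 : ℝ) ≤ A := by exact_mod_cast hA
  have hR' : (1 : ℝ) ≤ R := by exact_mod_cast hR
  have hlA := Real.log_nonneg hA'
  have hlR := Real.log_nonneg hR'
  have hb0 : 0 ≤ b := by positivity
  have hlim : Tendsto (fun N : ℕ => b ^ p * (N : ℝ) ^ (-(1 - p))) atTop (𝓝 (b ^ p * 0)) :=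
    ((tendsto_rpow_neg_atTop (by linarith)).comp tendsto_natCast_atTop_atTop).const_mul _
  rw [mul_zero] at hlim
  have hev := (hlim.eventually_le_const (u := (1 / 2 : ℝ) ^ J) (by positivity)).and
    ((eventually_ge_atTop N₀).and (eventually_ge_atTop 1))
  obtain ⟨N, hN, hN0, hN1⟩ := hev.exists
  refine ⟨N, hN0, hN1, ?_⟩
  have hN' : (1 : ℝ) ≤ N := by exact_mod_cast hN1
  have hlog : Real.log (A * (R : ℝ) ^ (4 * N + 1)) ≤ b * N := by
    rw [Real.log_mul (by positivity) (by positivity), Real.log_pow, hb]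
    push_cast
    nlinarith [mul_le_mul_of_nonneg_left hN' hlA, mul_le_mul_of_nonneg_left hN' hlR]
  have hlog0 : 0 ≤ Real.log (A * (R : ℝ) ^ (4 * N + 1)) :=
    Real.log_nonneg (one_le_mul_of_one_le_of_one_le hA' (one_le_pow₀ hR'))
  calc _ ≤ (b * N) ^ p := Real.rpow_le_rpow hlog0 hlog hp0.le
    _ = N * (b ^ p * (N : ℝ) ^ (-(1 - p))) := by
        have hNp : (N : ℝ) ^ p = N * (N : ℝ) ^ (-(1 - p)) := by
          rw [← Real.rpow_one_add' (by positivity) (by linarith)]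
          ring_nf
        rw [Real.mul_rpow hb0 (by positivity), hNp]
        ring
    _ ≤ _ := mul_le_mul_of_nonneg_left hN (by positivity)

/-- The stretching factor attached to a level. -/
def stretchFactor (J R N : ℕ) : ℕ := (J + 1) * R ^ (4 * N + 1)

/-- The sequences of integers that control the construction: `R` bounds the complexity of the lower
levels, `N` is the time horizon and `E` the precision of the noise. -/
theorem exists_parameters {p : ℝ} (hp0 : 0 < p) (hp1 : p < 1) (X D T : ℕ → ℕ)
    (hX : ∀ J, 1 ≤ X J) (hD : ∀ J, 1 ≤ D J) (hT : ∀ t, 1 ≤ T t) :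
    ∃ R N E : ℕ → ℕ, (∀ J, 3 ≤ R J) ∧ (∀ J, 2 * R J ≤ N J) ∧ (∀ J, 3 * R J ≤ E J) ∧
      (∀ J, R J * D J * T (stretchFactor J (R J) (N J)) * E J * N J = R (J + 1)) ∧
      (∀ J, Real.log (X J * stretchFactor J (R J) (N J)) ^ p ≤ N J * (1 / 2) ^ J) ∧
      ∀ J, 2 * (J + 1) * stretchFactor J (R J) (N J) * (2 * N J + 1) * R J ^ (2 * N J) *
        R J ^ (4 * (2 * N J + 1)) ≤ E J := by
  have hNex : ∀ J R : ℕ, ∃ N : ℕ, 2 * R ≤ N ∧ 1 ≤ N ∧ (1 ≤ R →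
      Real.log (X J * stretchFactor J R N) ^ p ≤ N * (1 / 2) ^ J) := by
    intro J R
    rcases Nat.eq_zero_or_pos R with rfl | hR
    · exact ⟨1, by omega, le_rfl, fun h => absurd h (by norm_num)⟩
    · obtain ⟨N, h1, h2, h3⟩ := exists_rpow_log_le hp0 hp1 (X J * (J + 1)) R (2 * R)
        (Nat.mul_pos (hX J) J.succ_pos) hR J
      refine ⟨N, h1, h2, fun _ => ?_⟩
      convert h3 using 3
      rw [stretchFactor]
      push_cast
      ring
  choose f hf1 hf2 hf3 using hNex
  let e : ℕ → ℕ → ℕ := fun J R => 3 * R + 2 * (J + 1) * stretchFactor J R (f J R) *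
    (2 * f J R + 1) * R ^ (2 * f J R) * R ^ (4 * (2 * f J R + 1))
  -- Each quantity of level `J` enters as a factor, so that its divisibility of `R (J + 1)`, and not
  -- only its size, is available at all later levels.
  let R : ℕ → ℕ := fun J => Nat.rec 3 (fun J r =>
    r * D J * T (stretchFactor J r (f J r)) * e J r * f J r) J
  have hRsucc : ∀ J, R (J + 1) =
      R J * D J * T (stretchFactor J (R J) (f J (R J))) * e J (R J) * f J (R J) := fun J => rfl
  have hR3 : ∀ J, 3 ≤ R J := by
    intro J
    induction J with
    | zero => exact le_rfl
    | succ J ih =>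
      rw [hRsucc]
      have h1 : 1 ≤ e J (R J) := by
        have : 3 * R J ≤ e J (R J) := Nat.le_add_right _ _
        omega
      calc 3 ≤ R J := ih
        _ ≤ R J * D J := Nat.le_mul_of_pos_right _ (hD J)
        _ ≤ R J * D J * T _ := Nat.le_mul_of_pos_right _ (hT _)
        _ ≤ R J * D J * T _ * e J (R J) := Nat.le_mul_of_pos_right _ h1
        _ ≤ _ := Nat.le_mul_of_pos_right _ (hf2 _ _)
  exact ⟨R, fun J => f J (R J), fun J => e J (R J), hR3, fun J => hf1 _ _,
    fun J => Nat.le_add_right _ _, fun J => (hRsucc J).symm,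
    fun J => hf3 _ _ (by linarith [hR3 J]), fun J => Nat.le_add_left _ _⟩

end Parameters

/-! ### Escape to the cusp up to the time horizon. -/

section Escape

open Matrix.SpecialLinearGroup

variable {d : ℕ}

/-- Every ordinary factor is a rational jump and a shear, hence two elements of `S`. The shear
following `a` is absorbed into `y`, whence the odd exponent. -/
theorem exists_factorization_of_mem_oneJump {S E U : Set (SLR d)} {a : SLR d} (hE : E ⊆ S ^ 2)
    (hU : U ⊆ S) {k : ℕ} {g : SLR d} (hg : g ∈ oneJump E ({a} * U) k) :
    ∃ i j x y, i + j + 1 = k ∧ x ∈ S ^ (2 * i) ∧ y ∈ S ^ (2 * j + 1) ∧ g = x * a * y := by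
  obtain ⟨i, j, hij, hg⟩ := exists_of_mem_oneJump hg
  obtain ⟨_, ⟨x, hx, _, ⟨b, hb, u, hu, rfl⟩, rfl⟩, y, hy, rfl⟩ := hg
  rw [Set.mem_singleton_iff] at hb
  subst hb
  refine ⟨i, j, x, u * y, hij, ?_, ?_, by simp only [mul_assoc]⟩
  · rw [pow_mul]; exact Set.pow_subset_pow_left hE hx
  · rw [pow_succ', pow_mul]
    exact Set.mul_mem_mul (hU hu) (Set.pow_subset_pow_left hE hy)

/-- Up to the time horizon `N`, a product with exactly one long jump is far in the cusp. -/
theorem exists_short_vector_of_mem_oneJump {J R N E : ℕ} (hR : 3 ≤ R)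
    (hE : 2 * (J + 1) * stretchFactor J R N * (2 * N + 1) * R ^ (2 * N) *
      R ^ (4 * (2 * N + 1)) ≤ E) {B U : Set (SLR d)} {a : SLR d}
    (hB : B ⊆ {g | NearIntegral R (2 * (E : ℝ)⁻¹) g} ^ 2)
    (hU : U ⊆ {g | NearIntegral R (2 * (E : ℝ)⁻¹) g})
    (hat : SupBound (stretchFactor J R N : ℕ) (a : Matrix (Fin d) (Fin d) ℝ)) (i₀ : Fin d)
    (ha : (a : Matrix (Fin d) (Fin d) ℝ).mulVec (Pi.single i₀ 1) =
      ((stretchFactor J R N : ℕ) : ℝ)⁻¹ • Pi.single i₀ 1)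
    {k : ℕ} (hk : k ≤ N) {g : SLR d} (hg : g ∈ oneJump B ({a} * U) k) :
    ∃ v : Fin d → ℤ, v ≠ 0 ∧
      ‖(g : Matrix (Fin d) (Fin d) ℝ).mulVec (intVec v)‖ ≤ 2 / (J + 1) := by
  obtain ⟨i, j, x, y, hij, hx, hy, rfl⟩ := exists_factorization_of_mem_oneJump hB hU hg
  set t : ℕ := stretchFactor J R N with ht
  have hR1 : (1 : ℝ) ≤ R := by exact_mod_cast (by omega : 1 ≤ R)
  have ht' : (t : ℝ) = (J + 1) * (R : ℝ) ^ (4 * N + 1) := by rw [ht, stretchFactor]; push_cast; ring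
  have hJ : (1 : ℝ) ≤ J + 1 := by linarith [J.cast_nonneg (α := ℝ)]
  have hRt : (R : ℝ) ≤ t := by
    rw [ht']
    calc (R : ℝ) = 1 * (R : ℝ) ^ 1 := by ring
      _ ≤ (J + 1) * (R : ℝ) ^ (4 * N + 1) :=
        mul_le_mul hJ (pow_le_pow_right₀ hR1 (by omega)) (by positivity) (by positivity)
  have ht3 : (3 : ℝ) ≤ t := le_trans (by exact_mod_cast hR) hRt
  have hE' : 2 * ((J : ℝ) + 1) * t * (2 * N + 1) * (R : ℝ) ^ (2 * N) *
      (R : ℝ) ^ (4 * (2 * N + 1)) ≤ E := by exact_mod_cast hE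
  have hpos : 0 < 2 * ((J : ℝ) + 1) * t * (2 * N + 1) * (R : ℝ) ^ (2 * N) *
      (R : ℝ) ^ (4 * (2 * N + 1)) := by positivity
  have hE0 : (0 : ℝ) < E := hpos.trans_le hE'
  -- The accumulated error of `y`; the lower bound on `E` is designed so that it stays at most `1 /
  -- (J + 1)` after multiplication by `t` and by the norm of `x`.
  set c : ℝ := ((2 * j + 1 : ℕ) : ℝ) * (R : ℝ) ^ (4 * (2 * j + 1)) * (2 * (E : ℝ)⁻¹) with hc
  have hc0 : 0 ≤ c := by positivity
  have hc1 : (R : ℝ) ^ (2 * N) * (t * c) ≤ 1 / (J + 1) := by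
    have h1 : c ≤ (2 * N + 1) * (R : ℝ) ^ (4 * (2 * N + 1)) * (2 * (E : ℝ)⁻¹) := by
      refine mul_le_mul_of_nonneg_right (mul_le_mul ?_ ?_ (by positivity) (by positivity))
        (by positivity)
      · exact_mod_cast (by omega : 2 * j + 1 ≤ 2 * N + 1)
      · exact pow_le_pow_right₀ hR1 (by omega)
    calc (R : ℝ) ^ (2 * N) * (t * c) ≤ (R : ℝ) ^ (2 * N) *
          (t * ((2 * N + 1) * (R : ℝ) ^ (4 * (2 * N + 1)) * (2 * (E : ℝ)⁻¹))) := by gcongr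
      _ = (2 * ((J : ℝ) + 1) * t * (2 * N + 1) * (R : ℝ) ^ (2 * N) *
            (R : ℝ) ^ (4 * (2 * N + 1))) * (E : ℝ)⁻¹ / (J + 1) := by
          field_simp
      _ ≤ 1 / (J + 1) := by
          refine div_le_div_of_nonneg_right ?_ (by positivity)
          rw [← div_eq_mul_inv, div_le_one hE0]
          exact hE'
  have hsmall : c < 1 := by
    have h1 : 1 * (3 * c) ≤ (R : ℝ) ^ (2 * N) * (t * c) :=
      mul_le_mul (one_le_pow₀ hR1) (mul_le_mul_of_nonneg_right ht3 hc0) (by positivity)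
        (by positivity)
    have h2 : 1 / ((J : ℝ) + 1) ≤ 1 := by rw [div_le_one (by positivity)]; exact hJ
    linarith
  obtain ⟨v, hv0, hv⟩ := exists_short_vector hR1 (by positivity) (fun g hg => hg) (by positivity)
    hat i₀ ha hx hy hsmall
  refine ⟨v, hv0, hv.trans ?_⟩
  rw [← hc, mul_add, ← mul_assoc, ← pow_add]
  have h3 : (R : ℝ) ^ (2 * i + (2 * j + 1)) * (t : ℝ)⁻¹ ≤ 1 / (J + 1) := by
    rw [ht', mul_inv, one_div, ← mul_assoc, mul_comm _ ((J : ℝ) + 1)⁻¹, mul_assoc]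
    refine mul_le_of_le_one_right (by positivity) ?_
    rw [← div_eq_mul_inv, div_le_one (by positivity)]
    exact pow_le_pow_right₀ hR1 (by omega)
  have h4 : (R : ℝ) ^ (2 * i) * (t * c) ≤ 1 / (J + 1) := by
    refine le_trans (mul_le_mul_of_nonneg_right ?_ (by positivity)) hc1
    exact pow_le_pow_right₀ hR1 (by omega)
  calc _ ≤ 1 / ((J : ℝ) + 1) + 1 / (J + 1) := add_le_add h3 h4
    _ = _ := by ring

/-- By Bernoulli's inequality the power is at least `1 / 2` for `k ≤ N`, so the loss at time `k` is
at least `k / (32 N)`; its mean over `k ≤ N` is `(N + 1) / (64 N)`. -/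
theorem average_le {N : ℕ} (hN : 1 ≤ N) {b : ℝ} (hb : 1 / (16 * N) ≤ b) {c : ℕ → ℝ}
    (hc : ∀ k ∈ Finset.Icc 1 N, c k ≤ 1 - k * (1 - 1 / (2 * N)) ^ (k - 1) * b) :
    (1 / (N : ℝ)) * ∑ k ∈ Finset.Icc 1 N, c k ≤ 1 - 1 / 64 := by
  have hN' : (1 : ℝ) ≤ N := by exact_mod_cast hN
  have hle : ∀ k ∈ Finset.Icc 1 N, c k ≤ 1 - k * (1 / (32 * N)) := by
    intro k hk
    obtain ⟨hk1, hkN⟩ := Finset.mem_Icc.1 hk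
    refine (hc k hk).trans (sub_le_sub_left ?_ 1)
    have h1 : (1 : ℝ) / 2 ≤ (1 - 1 / (2 * N)) ^ (k - 1) := by
      have hinv : (1 : ℝ) / (2 * N) ≤ 1 := by rw [div_le_one (by positivity)]; linarith
      have h2 := one_add_mul_le_pow (a := -(1 / (2 * (N : ℝ)))) (by linarith) (k - 1)
      rw [← sub_eq_add_neg] at h2
      refine le_trans ?_ h2
      have h3 : ((k - 1 : ℕ) : ℝ) ≤ N := by exact_mod_cast (by omega : k - 1 ≤ N)
      have h4 : ((k - 1 : ℕ) : ℝ) * (1 / (2 * (N : ℝ))) ≤ N * (1 / (2 * (N : ℝ))) :=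
        mul_le_mul_of_nonneg_right h3 (by positivity)
      have h5 : (N : ℝ) * (1 / (2 * (N : ℝ))) = 1 / 2 := by field_simp
      linarith
    calc (k : ℝ) * (1 / (32 * N)) = k * (1 / 2) * (1 / (16 * N)) := by field_simp; norm_num
      _ ≤ k * (1 - 1 / (2 * N)) ^ (k - 1) * b := by gcongr
  have hgauss : ∑ k ∈ Finset.Icc 1 N, (k : ℝ) = N * (N + 1) / 2 := by
    clear hc hle hb hN' hN
    induction N with
    | zero => simp
    | succ n ih => rw [Finset.sum_Icc_succ_top (by omega), ih]; push_cast; ring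
  have hsum : ∑ k ∈ Finset.Icc 1 N, c k ≤ N - N * (N + 1) / 2 * (1 / (32 * N)) := by
    refine (Finset.sum_le_sum hle).trans (le_of_eq ?_)
    rw [Finset.sum_sub_distrib, ← Finset.sum_mul, hgauss]
    simp
  calc (1 / (N : ℝ)) * ∑ k ∈ Finset.Icc 1 N, c k
      ≤ (1 / (N : ℝ)) * (N - N * (N + 1) / 2 * (1 / (32 * N))) := by gcongr
    _ = 1 - (1 + 1 / N) / 64 := by field_simp; ring
    _ ≤ 1 - 1 / 64 := by
        have : (0 : ℝ) ≤ 1 / N := by positivity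
        linarith

end Escape

/-! ### Mixtures with telescoping weights. -/

section Mixture

variable {G : Type*} [MeasurableSpace G]

/-- The mixture of the measures `ν j` with weights `W j - W (j + 1)`. -/
noncomputable def telescopingMixture (W : ℕ → ℝ) (ν : ℕ → Measure G) : Measure G :=
  Measure.sum fun j => ENNReal.ofReal (W j - W (j + 1)) • ν j

/-- The part of the mixture coming from the indices below `J`. -/
noncomputable def partialMixture (W : ℕ → ℝ) (ν : ℕ → Measure G) (J : ℕ) : Measure G :=
  ∑ j ∈ Finset.range J, ENNReal.ofReal (W j - W (j + 1)) • ν j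

variable {W : ℕ → ℝ} {ν : ℕ → Measure G}

theorem isProbabilityMeasure_telescopingMixture [∀ j, IsProbabilityMeasure (ν j)]
    (hW0 : W 0 = 1) (hW : Antitone W) (hlim : Tendsto W atTop (𝓝 0)) :
    IsProbabilityMeasure (telescopingMixture W ν) := by
  have hnn : ∀ j, 0 ≤ W j - W (j + 1) := fun j => sub_nonneg.2 (hW j.le_succ)
  have hsum : HasSum (fun j => W j - W (j + 1)) 1 := by
    rw [hasSum_iff_tendsto_nat_of_nonneg hnn]
    simp only [Finset.sum_range_sub', hW0]
    simpa using hlim.const_sub 1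
  refine ⟨?_⟩
  rw [telescopingMixture, Measure.sum_apply _ MeasurableSet.univ]
  simp only [Measure.smul_apply, measure_univ, smul_eq_mul, mul_one]
  rw [← ENNReal.ofReal_tsum_of_nonneg hnn hsum.summable, hsum.tsum_eq, ENNReal.ofReal_one]

instance isFiniteMeasure_partialMixture [∀ j, IsProbabilityMeasure (ν j)] (J : ℕ) :
    IsFiniteMeasure (partialMixture W ν J) := by
  refine ⟨?_⟩
  rw [partialMixture, Measure.coe_finsetSum, Finset.sum_apply]
  refine ENNReal.sum_lt_top.2 fun j _ => ?_
  simp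

theorem partialMixture_real_univ [∀ j, IsProbabilityMeasure (ν j)] (hW0 : W 0 = 1)
    (hW : Antitone W) (J : ℕ) : (partialMixture W ν J).real Set.univ = 1 - W J := by
  have hnn : ∀ j, 0 ≤ W j - W (j + 1) := fun j => sub_nonneg.2 (hW j.le_succ)
  have h : partialMixture W ν J Set.univ = ENNReal.ofReal (1 - W J) := by
    rw [partialMixture, Measure.coe_finsetSum, Finset.sum_apply, ← hW0, ← Finset.sum_range_sub',
      ENNReal.ofReal_sum_of_nonneg fun j _ => hnn j]
    simp
  rw [measureReal_def, h, ENNReal.toReal_ofReal]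
  rw [← hW0]
  exact sub_nonneg.2 (hW J.zero_le)

theorem partialMixture_add_le (J : ℕ) :
    partialMixture W ν J + ENNReal.ofReal (W J - W (J + 1)) • ν J ≤ telescopingMixture W ν := by
  rw [partialMixture, ← Finset.sum_range_succ
    (fun j => ENNReal.ofReal (W j - W (j + 1)) • ν j), Measure.le_iff]
  intro s hs
  rw [telescopingMixture, Measure.sum_apply _ hs, Measure.coe_finsetSum, Finset.sum_apply]
  exact ENNReal.sum_le_tsum _

theorem partialMixture_eq_zero {s : Set G} {J : ℕ} (h : ∀ j < J, ν j s = 0) :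
    partialMixture W ν J s = 0 := by
  rw [partialMixture, Measure.coe_finsetSum, Finset.sum_apply]
  exact Finset.sum_eq_zero fun j hj => by simp [h j (Finset.mem_range.1 hj)]

end Mixture

/-! ### The law of a single level. -/

section Level

open Matrix.SpecialLinearGroup

variable {d : ℕ} {i j : Fin d} (hij : i ≠ j)

/-- The law of `h u(s)` with `u(s)` a shear whose parameter has law `κ`. -/
noncomputable def shearLaw (κ : Measure ℝ) (h : SLR d) : Measure (SLR d) :=
  κ.map fun s => h * transvection hij s

/-- The symmetrized law of a jump by `q` or `a`, perturbed by a random shear. -/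
noncomputable def levelLaw (κ : Measure ℝ) (q a : SLR d) : Measure (SLR d) :=
  (4⁻¹ : ℝ≥0∞) • ((shearLaw hij κ q + shearLaw hij κ a) +
    (shearLaw hij κ q + shearLaw hij κ a).map fun g => g⁻¹)

/-- A compact set carrying `levelLaw`. -/
def levelCarrier (Θ : Set ℝ) (q a : SLR d) : Set (SLR d) :=
  {q, a} * ((fun s : ℝ => (transvection hij s : SLR d)) '' Θ) ∪
    ({q, a} * ((fun s : ℝ => (transvection hij s : SLR d)) '' Θ))⁻¹

variable {κ : Measure ℝ} {Θ : Set ℝ} (q a h : SLR d)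

theorem continuous_mul_transvection :
    Continuous fun s : ℝ => h * (transvection hij s : SLR d) :=
  continuous_const.mul (continuous_transvection hij)

instance isProbabilityMeasure_shearLaw [IsProbabilityMeasure κ] : IsProbabilityMeasure (shearLaw hij κ h) :=
  Measure.isProbabilityMeasure_map (continuous_mul_transvection hij h).measurable.aemeasurable

theorem isProbabilityMeasure_levelLaw [IsProbabilityMeasure κ] :
    IsProbabilityMeasure (levelLaw hij κ q a) := by
  refine ⟨?_⟩
  rw [levelLaw, Measure.smul_apply, Measure.add_apply, Measure.map_apply measurable_inv
    MeasurableSet.univ, Set.preimage_univ, Measure.add_apply, measure_univ, measure_univ,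
    smul_eq_mul]
  rw [show (1 + 1 + (1 + 1) : ℝ≥0∞) = 4 by norm_num]
  exact ENNReal.inv_mul_cancel (by norm_num) (by norm_num)

theorem map_inv_levelLaw :
    (levelLaw hij κ q a).map (fun g => g⁻¹) = levelLaw hij κ q a := by
  rw [levelLaw, Measure.map_smul, Measure.map_add _ _ measurable_inv,
    Measure.map_map measurable_inv measurable_inv]
  simp only [Function.comp_def, inv_inv]
  rw [Measure.map_id', add_comm]

theorem shearLaw_singleton (hκ : ∀ s, κ {s} = 0) (g : SLR d) : shearLaw hij κ h {g} = 0 := by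
  rw [shearLaw, Measure.map_apply (continuous_mul_transvection hij h).measurable
    (measurableSet_singleton g)]
  have hsub : ((fun s : ℝ => h * (transvection hij s : SLR d)) ⁻¹' {g}).Subsingleton :=
    fun s hs t ht => transvection_injective hij (mul_left_cancel (hs.trans ht.symm))
  rcases hsub.eq_empty_or_singleton with h0 | ⟨s, h0⟩
  · rw [h0, measure_empty]
  · rw [h0, hκ]

theorem levelLaw_singleton (hκ : ∀ s, κ {s} = 0) (g : SLR d) : levelLaw hij κ q a {g} = 0 := by
  rw [levelLaw, Measure.smul_apply, Measure.add_apply, Measure.map_apply measurable_inv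
    (measurableSet_singleton g), Set.inv_preimage, Set.inv_singleton]
  simp [shearLaw_singleton hij _ hκ]

theorem isCompact_levelCarrier (hΘ : IsCompact Θ) : IsCompact (levelCarrier hij Θ q a) := by
  have h1 : IsCompact ({q, a} * ((fun s : ℝ => (transvection hij s : SLR d)) '' Θ)) :=
    (Set.toFinite _).isCompact.mul (hΘ.image (continuous_transvection hij))
  exact h1.union h1.inv

theorem shearLaw_compl_eq_zero (hκ : κ Θᶜ = 0) {B : Set (SLR d)}
    (hB : IsCompact B) (hsub : {h} * ((fun s : ℝ => (transvection hij s : SLR d)) '' Θ) ⊆ B) :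
    shearLaw hij κ h Bᶜ = 0 := by
  rw [shearLaw, Measure.map_apply (continuous_mul_transvection hij h).measurable
    hB.measurableSet.compl]
  refine measure_mono_null (t := Θᶜ) (fun s hs hsΘ => hs (hsub ?_)) hκ
  exact Set.mul_mem_mul rfl ⟨s, hsΘ, rfl⟩

theorem levelLaw_compl_levelCarrier (hΘ : IsCompact Θ) (hκ : κ Θᶜ = 0) :
    levelLaw hij κ q a (levelCarrier hij Θ q a)ᶜ = 0 := by
  have hC := isCompact_levelCarrier hij q a hΘ
  have hinv : (levelCarrier hij Θ q a)⁻¹ = levelCarrier hij Θ q a := by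
    rw [levelCarrier, Set.union_inv, inv_inv, Set.union_comm]
  have hmem : ∀ h ∈ ({q, a} : Set (SLR d)),
      shearLaw hij κ h (levelCarrier hij Θ q a)ᶜ = 0 := fun h hh =>
    shearLaw_compl_eq_zero hij h hκ hC (Set.subset_union_of_subset_left
      (Set.mul_subset_mul_right (Set.singleton_subset_iff.2 hh)) _)
  have hpre : (fun g : SLR d => g⁻¹) ⁻¹' (levelCarrier hij Θ q a)ᶜ =
      (levelCarrier hij Θ q a)ᶜ := by
    rw [Set.preimage_compl, Set.inv_preimage, hinv]
  rw [levelLaw, Measure.smul_apply, Measure.add_apply, Measure.map_apply measurable_inv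
    hC.measurableSet.compl, hpre, Measure.add_apply, hmem q (by simp), hmem a (by simp)]
  simp

theorem shearLaw_le_levelLaw : (4⁻¹ : ℝ≥0∞) • shearLaw hij κ a ≤ levelLaw hij κ q a := by
  rw [levelLaw, Measure.le_iff]
  intro s _
  simp only [Measure.smul_apply, Measure.add_apply, smul_eq_mul]
  gcongr
  exact le_add_right le_add_self

theorem levelLaw_pos_of_isOpen {s₀ : ℝ} (hs₀ : s₀ ∈ κ.support) {V : Set (SLR d)}
    (hV : IsOpen V) (hmem : q * transvection hij s₀ ∈ V) : 0 < levelLaw hij κ q a V := by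
  have hc := continuous_mul_transvection hij q
  have h1 : 0 < shearLaw hij κ q V := by
    rw [shearLaw, Measure.map_apply hc.measurable hV.measurableSet]
    exact (Measure.mem_support_iff_forall s₀).1 hs₀ _ ((hV.preimage hc).mem_nhds hmem)
  rw [levelLaw, Measure.smul_apply, Measure.add_apply, Measure.add_apply, smul_eq_mul]
  exact ENNReal.mul_pos (by norm_num) (by positivity)

end Level

/-! ### Near integrality and moments of the levels. -/

section LevelBounds

open Matrix.SpecialLinearGroup

variable {d : ℕ} {i j : Fin d} (hij : i ≠ j) {E : ℕ → ℕ}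

theorem nearIntegral_transvection_lacunarySum (hE0 : ∀ n, 1 ≤ E n)
    (hE : ∀ n, 3 * E n ≤ E (n + 1)) {R J : ℕ} (hR3 : 3 ≤ R) (hR : ∀ n < J, E n ∣ R) (x : ℕ → Bool) :
    NearIntegral R (2 * (E J : ℝ)⁻¹) (transvection hij (lacunarySum E x) : SLR d) ∧
      NearIntegral R (2 * (E J : ℝ)⁻¹) (transvection hij (lacunarySum E x) : SLR d)⁻¹ := by
  obtain ⟨hs, s', hs', hss, z, hz⟩ := exists_approx_lacunarySum hE0 hE x hR
  refine ⟨nearIntegral_transvection hij hR3 hs hs' hss z hz, ?_⟩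
  rw [transvection_inv]
  refine nearIntegral_transvection hij hR3 (s' := -s') (by rwa [abs_neg]) (by rwa [abs_neg]) ?_
    (-z) (by push_cast; rw [← hz]; ring)
  rw [← neg_add', abs_neg, ← sub_eq_add_neg]
  exact hss

theorem levelCarrier_subset_sq {Θ : Set ℝ} {q a : SLR d} {S : Set (SLR d)}
    (hq : q ∈ S ∧ q⁻¹ ∈ S) (ha : a ∈ S ∧ a⁻¹ ∈ S)
    (hΘ : ∀ s ∈ Θ, (transvection hij s : SLR d) ∈ S ∧ (transvection hij s : SLR d)⁻¹ ∈ S) :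
    levelCarrier hij Θ q a ⊆ S ^ 2 := by
  rw [sq]
  have hmem : ∀ h ∈ ({q, a} : Set (SLR d)), h ∈ S ∧ h⁻¹ ∈ S := by
    rintro h (rfl | rfl)
    exacts [hq, ha]
  rintro g (⟨h, hh, _, ⟨s, hs, rfl⟩, rfl⟩ | ⟨h, hh, _, ⟨s, hs, rfl⟩, hg⟩)
  · exact Set.mul_mem_mul (hmem h hh).1 (hΘ s hs).1
  · rw [← inv_inv g, ← hg]
    simp only [mul_inv_rev]
    exact Set.mul_mem_mul (hΘ s hs).2 (hmem h hh).2

theorem supBound_of_mem_levelCarrier {Θ : Set ℝ} (hΘ : ∀ s ∈ Θ, |s| ≤ 2) {q a : SLR d} {c : ℝ}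
    (hc : 0 ≤ c)
    (hq : SupBound c (q : Matrix (Fin d) (Fin d) ℝ) ∧
      SupBound c ((q⁻¹ : SLR d) : Matrix (Fin d) (Fin d) ℝ))
    (ha : SupBound c (a : Matrix (Fin d) (Fin d) ℝ) ∧
      SupBound c ((a⁻¹ : SLR d) : Matrix (Fin d) (Fin d) ℝ))
    {g : SLR d} (hg : g ∈ levelCarrier hij Θ q a) :
    SupBound (3 * c) (g : Matrix (Fin d) (Fin d) ℝ) ∧
      SupBound (3 * c) ((g⁻¹ : SLR d) : Matrix (Fin d) (Fin d) ℝ) := by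
  have hmem : ∀ h ∈ ({q, a} : Set (SLR d)), SupBound c (h : Matrix (Fin d) (Fin d) ℝ) ∧
      SupBound c ((h⁻¹ : SLR d) : Matrix (Fin d) (Fin d) ℝ) := by
    rintro h (rfl | rfl)
    exacts [hq, ha]
  have key : ∀ h ∈ ({q, a} : Set (SLR d)), ∀ s ∈ Θ,
      SupBound (3 * c) ((h * transvection hij s : SLR d) : Matrix (Fin d) (Fin d) ℝ) ∧
      SupBound (3 * c) (((h * transvection hij s)⁻¹ : SLR d) : Matrix (Fin d) (Fin d) ℝ) := by
    intro h hh s hs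
    have h1 := supBound_transvection hij (hΘ s hs)
    have h2 := supBound_transvection hij (s := -s) (c := 2) (by rw [abs_neg]; exact hΘ s hs)
    constructor
    · rw [coe_mul]
      exact ((hmem h hh).1.mul hc h1).mono (by linarith)
    · rw [mul_inv_rev, transvection_inv, coe_mul]
      exact (h2.mul (by norm_num) (hmem h hh).2).mono (by linarith)
  rcases hg with ⟨h, hh, _, ⟨s, hs, rfl⟩, rfl⟩ | ⟨h, hh, _, ⟨s, hs, rfl⟩, hg⟩
  · exact key h hh s hs
  · rw [← inv_inv g, ← hg, inv_inv]
    exact (key h hh s hs).symm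

theorem lintegral_levelLaw_le {κ : Measure ℝ} [IsProbabilityMeasure κ] {Θ : Set ℝ}
    (hΘc : IsCompact Θ) (hκ : κ Θᶜ = 0) (hΘ : ∀ s ∈ Θ, |s| ≤ 2) {q a : SLR d} {c : ℝ}
    (hc : 1 ≤ c) (hd : 0 < d) {p : ℝ} (hp : 0 ≤ p)
    (hq : SupBound c (q : Matrix (Fin d) (Fin d) ℝ) ∧
      SupBound c ((q⁻¹ : SLR d) : Matrix (Fin d) (Fin d) ℝ))
    (ha : SupBound c (a : Matrix (Fin d) (Fin d) ℝ) ∧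
      SupBound c ((a⁻¹ : SLR d) : Matrix (Fin d) (Fin d) ℝ)) :
    ∫⁻ g, ENNReal.ofReal (Real.log (opNorm g) ^ p) ∂(levelLaw hij κ q a) ≤
      ENNReal.ofReal (Real.log (d * (3 * c)) ^ p) := by
  have hprob := isProbabilityMeasure_levelLaw hij (κ := κ) q a
  have hae : ∀ᵐ g ∂(levelLaw hij κ q a), g ∈ levelCarrier hij Θ q a :=
    mem_ae_iff.2 (levelLaw_compl_levelCarrier hij q a hΘc hκ)
  calc _ ≤ ∫⁻ _, ENNReal.ofReal (Real.log (d * (3 * c)) ^ p) ∂(levelLaw hij κ q a) := by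
        refine lintegral_mono_ae (hae.mono fun g hg => ENNReal.ofReal_le_ofReal ?_)
        obtain ⟨h1, h2⟩ := supBound_of_mem_levelCarrier hij hΘ (by linarith) hq ha hg
        have h3 := abs_log_opNorm_le hd (by linarith) h1 h2
        -- Absolute values are used since monotonicity of `x ^ p` requires nonnegative bases.
        calc Real.log (opNorm g) ^ p ≤ |Real.log (opNorm g) ^ p| := le_abs_self _
          _ ≤ |Real.log (opNorm g)| ^ p := Real.abs_rpow_le_abs_rpow _ _
          _ ≤ _ := Real.rpow_le_rpow (abs_nonneg _) h3 hp
    _ = _ := by rw [lintegral_const, measure_univ, mul_one]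

end LevelBounds

/-! ### Tail weights. -/

section Weights

/-- The tail weights: `1` at level `0` and `1 / (2 N_J)` at level `J ≥ 1`. -/
noncomputable def tailWeight (N : ℕ → ℕ) : ℕ → ℝ
  | 0 => 1
  | J + 1 => 1 / (2 * N (J + 1))

variable {N : ℕ → ℕ}

theorem tailWeight_succ_le (hN1 : ∀ J, 1 ≤ N J) (hN : ∀ J, 2 * N J ≤ N (J + 1)) (J : ℕ) :
    tailWeight N (J + 1) ≤ tailWeight N J / 2 := by
  have h1 : ∀ J, (1 : ℝ) ≤ N J := fun J => by exact_mod_cast hN1 J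
  rcases J with _ | J
  · simp only [tailWeight]
    exact one_div_le_one_div_of_le (by norm_num) (by linarith [h1 1])
  · simp only [tailWeight]
    have h2 : (2 : ℝ) * N (J + 1) ≤ N (J + 2) := by exact_mod_cast hN (J + 1)
    have h3 := h1 (J + 1)
    rw [div_div]
    exact one_div_le_one_div_of_le (by positivity) (by linarith)

theorem tailWeight_nonneg (J : ℕ) : 0 ≤ tailWeight N J := by
  rcases J with _ | J <;> simp only [tailWeight] <;> positivity

theorem tailWeight_pos (hN1 : ∀ J, 1 ≤ N J) (J : ℕ) : 0 < tailWeight N J := by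
  rcases J with _ | J
  · exact one_pos
  · have h1 : (1 : ℝ) ≤ N (J + 1) := by exact_mod_cast hN1 _
    simp only [tailWeight]
    positivity

theorem antitone_tailWeight (hN1 : ∀ J, 1 ≤ N J) (hN : ∀ J, 2 * N J ≤ N (J + 1)) :
    Antitone (tailWeight N) :=
  antitone_nat_of_succ_le fun J => (tailWeight_succ_le hN1 hN J).trans
    (half_le_self (tailWeight_nonneg J))

theorem tendsto_tailWeight (hN1 : ∀ J, 1 ≤ N J) (hN : ∀ J, 2 * N J ≤ N (J + 1)) :
    Tendsto (tailWeight N) atTop (𝓝 0) := by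
  have hle : ∀ J, tailWeight N J ≤ (1 / 2) ^ J := by
    intro J
    induction J with
    | zero => simp [tailWeight]
    | succ J ih =>
      rw [pow_succ]
      linarith [tailWeight_succ_le hN1 hN J]
  exact squeeze_zero tailWeight_nonneg hle
    (tendsto_pow_atTop_nhds_zero_of_lt_one (by norm_num) (by norm_num))

/-- The product is `1 / 2` at positive levels; the bound `N 0` is dictated by level `0`, whose
weight is `1`. It cancels the factor `N J` in the moment estimate. -/
theorem tailWeight_mul_le (hN1 : ∀ J, 1 ≤ N J) (J : ℕ) : tailWeight N J * N J ≤ N 0 := by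
  have h1 : ∀ J, (1 : ℝ) ≤ N J := fun J => by exact_mod_cast hN1 J
  rcases J with _ | J
  · simp [tailWeight]
  · have h2 := h1 (J + 1)
    have h3 : tailWeight N (J + 1) * N (J + 1) = 1 / 2 := by
      simp only [tailWeight]
      field_simp
    linarith [h1 0]

end Weights

/-! ### Assembly of the measure. -/

theorem theorem1p3 (p : ℝ) (hp0 : 0 < p) (hp1 : p < 1) (d : ℕ) (hd : 2 ≤ d) :
    ∃ ε : ℝ, 0 < ε ∧ ∃ μ : Measure (SLR d),
      IsProbabilityMeasure μ ∧
      μ.map (fun g => g⁻¹) = μ ∧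
      HasFiniteLpMoment p μ ∧
      (∀ g : SLR d, μ {g} = 0) ∧
      μ.support = Set.univ ∧
      ∀ K : Set (LatticeSpace d), IsCompact K →
        liminf (fun n : ℕ =>
          (1 / (n : ℝ)) * ∑ k ∈ Finset.Icc 1 n, (convPow μ k).real (cosetUnion K)) atTop
          ≤ 1 - ε := by
  let i₀ : Fin d := ⟨0, by omega⟩
  let i₁ : Fin d := ⟨1, by omega⟩
  have hij : i₀ ≠ i₁ := fun h => by simpa [i₀, i₁] using congrArg Fin.val h
  have hd0 : 0 < d := by omega
  have : Countable (Matrix.SpecialLinearGroup (Fin d) ℚ) := by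
    have : Countable (Matrix (Fin d) (Fin d) ℚ) :=
      inferInstanceAs (Countable (Fin d → Fin d → ℚ))
    exact Subtype.countable
  obtain ⟨q, hq⟩ := exists_surjective_nat (Matrix.SpecialLinearGroup (Fin d) ℚ)
  choose X hX1 hXq hXq' using fun J => exists_supBound (ratSL d (q J))
  choose D hD1 hD using fun J => exists_nearIntegral_ratSL_inv (q J)
  choose a ha using exists_stretch hij
  choose T hT1 hT using fun t => exists_nearIntegral_ratSL_inv (a t)
  obtain ⟨R, N, E, hR3, hRN, hRE, hRsucc, hlog, hEbig⟩ := exists_parameters hp0 hp1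
    (fun J => d * (3 * X J)) D T (fun J => Nat.mul_pos hd0 (by linarith [hX1 J])) hD1 hT1
  let t : ℕ → ℕ := fun J => stretchFactor J (R J) (N J)
  have ht1 : ∀ J, 1 ≤ t J := fun J =>
    Nat.mul_pos J.succ_pos (pow_pos (by linarith [hR3 J]) _)
  have hN1 : ∀ J, 1 ≤ N J := fun J => by linarith [hR3 J, hRN J]
  have hE1 : ∀ J, 1 ≤ E J := fun J => by linarith [hR3 J, hRE J]
  have hRpos : ∀ J, 0 < R J := fun J => by linarith [hR3 J]
  have hNdvd : ∀ J, N J ∣ R (J + 1) := fun J => hRsucc J ▸ dvd_mul_left _ _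
  have hEdvd : ∀ J, E J ∣ R (J + 1) := fun J => hRsucc J ▸ (dvd_mul_left _ _).mul_right _
  have hTdvd : ∀ J, T (t J) ∣ R (J + 1) := fun J =>
    hRsucc J ▸ ((dvd_mul_left _ _).mul_right _).mul_right _
  have hDdvd : ∀ J, D J ∣ R (J + 1) := fun J =>
    hRsucc J ▸ (((dvd_mul_left _ _).mul_right _).mul_right _).mul_right _
  have hRdvd : ∀ J, R J ∣ R (J + 1) := fun J =>
    hRsucc J ▸ (((dvd_mul_right _ _).mul_right _).mul_right _).mul_right _
  have hRmono : ∀ {m n : ℕ}, m < n → R (m + 1) ∣ R n := fun {m n} hmn =>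
    Nat.le_induction (m := m + 1) (P := fun n _ => R (m + 1) ∣ R n) dvd_rfl
      (fun n _ ih => ih.trans (hRdvd n)) n hmn
  have hN2 : ∀ J, 2 * N J ≤ N (J + 1) := fun J => by
    linarith [hRN (J + 1), Nat.le_of_dvd (hRpos _) (hNdvd J)]
  have hE3 : ∀ J, 3 * E J ≤ E (J + 1) := fun J => by
    linarith [hRE (J + 1), Nat.le_of_dvd (hRpos _) (hEdvd J)]
  obtain ⟨κ, hκp, hκa, hκΘ⟩ := exists_noise_measure hE1 hE3
  set Θ : Set ℝ := Set.range (lacunarySum E)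
  have hΘc : IsCompact Θ := isCompact_range (continuous_lacunarySum hE1 hE3)
  have hΘ2 : ∀ s ∈ Θ, |s| ≤ 2 := by
    rintro _ ⟨x, rfl⟩
    -- Only the bound by `2` is needed, so the truncation is taken empty.
    exact (exists_approx_lacunarySum hE1 hE3 x (R := 0) (J := 0) (by simp)).1
  let Q : ℕ → SLR d := fun J => ratSL d (q J)
  let A : ℕ → SLR d := fun J => ratSL d (a (t J))
  let ν : ℕ → Measure (SLR d) := fun J => levelLaw hij κ (Q J) (A J)
  have hνp : ∀ J, IsProbabilityMeasure (ν J) := fun J => isProbabilityMeasure_levelLaw hij _ _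
  let W : ℕ → ℝ := tailWeight N
  have hWa : Antitone W := antitone_tailWeight hN1 hN2
  have hWsub : ∀ J, W J / 2 ≤ W J - W (J + 1) := fun J => by
    have : W (J + 1) ≤ W J / 2 := tailWeight_succ_le hN1 hN2 J
    linarith
  let μ : Measure (SLR d) := telescopingMixture W ν
  have hμp : IsProbabilityMeasure μ :=
    isProbabilityMeasure_telescopingMixture rfl hWa (tendsto_tailWeight hN1 hN2)
  refine ⟨1 / 64, by norm_num, μ, hμp, ?_, ?_, ?_, ?_, ?_⟩
  · simp only [μ, telescopingMixture]
    rw [Measure.map_sum measurable_inv.aemeasurable]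
    simp only [Measure.map_smul, ν, map_inv_levelLaw]
  · have hterm : ∀ J, ∫⁻ g, ENNReal.ofReal (Real.log (opNorm g) ^ p)
        ∂(ENNReal.ofReal (W J - W (J + 1)) • ν J) ≤ ENNReal.ofReal (N 0 * (1 / 2) ^ J) := by
      intro J
      have hX' : (1 : ℝ) ≤ X J := by exact_mod_cast hX1 J
      have ht' : (1 : ℝ) ≤ t J := by exact_mod_cast ht1 J
      obtain ⟨ha1, ha2, -⟩ := ha (t J) (ht1 J)
      have hcX : (X J : ℝ) ≤ X J * t J := le_mul_of_one_le_right (by linarith) ht'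
      have hct : (t J : ℝ) ≤ X J * t J := le_mul_of_one_le_left (by linarith) hX'
      have hlevel := lintegral_levelLaw_le hij hΘc hκΘ hΘ2 (hX'.trans hcX) hd0 hp0.le
        ⟨(hXq J).mono hcX, (hXq' J).mono hcX⟩ ⟨ha1.mono hct, ha2.mono hct⟩
      have hlogJ : Real.log (d * (3 * (X J * t J))) ^ p ≤ N J * (1 / 2) ^ J := by
        convert hlog J using 3
        push_cast
        ring
      have hW0 : 0 ≤ W J := tailWeight_nonneg J
      rw [lintegral_smul_measure, smul_eq_mul]
      calc _ ≤ ENNReal.ofReal (W J) * ENNReal.ofReal (N J * (1 / 2) ^ J) := by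
            refine mul_le_mul' (ENNReal.ofReal_le_ofReal ?_)
              (hlevel.trans (ENNReal.ofReal_le_ofReal hlogJ))
            have : 0 ≤ W (J + 1) := tailWeight_nonneg _
            linarith
        _ = ENNReal.ofReal (W J * N J * (1 / 2) ^ J) := by
            rw [← ENNReal.ofReal_mul hW0, mul_assoc]
        _ ≤ _ := ENNReal.ofReal_le_ofReal
            (mul_le_mul_of_nonneg_right (tailWeight_mul_le hN1 J) (by positivity))
    rw [HasFiniteLpMoment]
    simp only [μ, telescopingMixture]
    rw [lintegral_sum_measure]
    refine (ENNReal.tsum_le_tsum hterm).trans_lt ?_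
    rw [← ENNReal.ofReal_tsum_of_nonneg (fun J => by positivity)
      ((summable_geometric_of_lt_one (by norm_num) (by norm_num)).mul_left _)]
    exact ENNReal.ofReal_lt_top
  · intro g
    simp only [μ, telescopingMixture]
    rw [Measure.sum_apply _ (measurableSet_singleton g)]
    simp [ν, levelLaw_singleton hij _ _ hκa]
  · obtain ⟨s₀, hs₀⟩ := Measure.nonempty_support (μ := κ) (IsProbabilityMeasure.ne_zero κ)
    have hpos : ∀ V : Set (SLR d), IsOpen V → V.Nonempty → μ V ≠ 0 := by
      intro V hV hVne
      let u : SLR d := Matrix.SpecialLinearGroup.transvection hij s₀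
      -- Right translation by the shear at a support point `s₀` of the noise preserves density, so
      -- some `q J` times that shear lies in `V`.
      obtain ⟨r, hr⟩ := (denseRange_ratSL hd0).exists_mem_open
        (hV.preimage (continuous_mul_const u))
        (by obtain ⟨v, hv⟩ := hVne; exact ⟨v * u⁻¹, by simpa using hv⟩)
      obtain ⟨J, rfl⟩ := hq r
      have h1 : 0 < ν J V := levelLaw_pos_of_isOpen hij (Q J) (A J) hs₀ hV hr
      have h2 : ENNReal.ofReal (W J - W (J + 1)) * ν J V ≤ μ V :=
        le_trans ((Measure.le_add_left le_rfl) V) ((partialMixture_add_le (W := W) (ν := ν) J) V)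
      have h3 : 0 < W J := tailWeight_pos hN1 J
      have h4 : 0 < ENNReal.ofReal (W J - W (J + 1)) :=
        ENNReal.ofReal_pos.2 (by linarith [hWsub J])
      exact ((ENNReal.mul_pos h4.ne' h1.ne').trans_le h2).ne'
    have : μ.IsOpenPosMeasure := ⟨hpos⟩
    exact Measure.support_eq_univ
  · intro K hK
    obtain ⟨r, hr, hKr⟩ := exists_systole_bound hK
    have hbound : ∀ J : ℕ, 1 ≤ J → 2 / ((J : ℝ) + 1) < r →
        (1 / (N J : ℝ)) * ∑ k ∈ Finset.Icc 1 (N J), (convPow μ k).real (cosetUnion K)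
          ≤ 1 - 1 / 64 := by
      intro J hJ1 hJr
      let S : Set (SLR d) := {g | NearIntegral (R J) (2 * (E J : ℝ)⁻¹) g}
      let U : Set (SLR d) :=
        (fun s : ℝ => (Matrix.SpecialLinearGroup.transvection hij s : SLR d)) '' Θ
      let B : Set (SLR d) := ⋃ j ∈ Finset.range J, levelCarrier hij Θ (Q j) (A j)
      have hUc : IsCompact U := hΘc.image (continuous_transvection hij)
      have hFc : IsCompact ({A J} * U) := isCompact_singleton.mul hUc
      have hBc : IsCompact B := (Finset.range J).isCompact_biUnion fun j _ =>
        isCompact_levelCarrier hij _ _ hΘc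
      have hshear : ∀ s ∈ Θ, (Matrix.SpecialLinearGroup.transvection hij s : SLR d) ∈ S ∧
          (Matrix.SpecialLinearGroup.transvection hij s : SLR d)⁻¹ ∈ S := by
        rintro _ ⟨x, rfl⟩
        exact nearIntegral_transvection_lacunarySum hij hE1 hE3 (hR3 J)
          (fun n hn => (hEdvd n).trans (hRmono hn)) x
      have hBS : B ⊆ S ^ 2 := by
        refine Set.iUnion₂_subset fun j hj => ?_
        have hdiv := hRmono (Finset.mem_range.1 hj)
        exact levelCarrier_subset_sq hij
          (hD j (R J) ((hDdvd j).trans hdiv) (hRpos J) _ (by positivity))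
          (hT (t j) (R J) ((hTdvd j).trans hdiv) (hRpos J) _ (by positivity)) hshear
      have hUS : U ⊆ S := by
        rintro _ ⟨s, hs, rfl⟩
        exact (hshear s hs).1
      -- Only the quarter of level `J` carried by the stretch is kept: the rational jump `Q J` need
      -- not be nearly integral at scale `R J`.
      let β : Measure (SLR d) :=
        (ENNReal.ofReal (W J - W (J + 1)) * 4⁻¹) • shearLaw hij κ (A J)
      have hβfin : IsFiniteMeasure β :=
        ⟨by simp [β, ENNReal.mul_lt_top_iff]⟩
      have hle : partialMixture W ν J + β ≤ μ := by
        refine le_trans (add_le_add le_rfl ?_) (partialMixture_add_le J)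
        simp only [β, mul_smul]
        rw [Measure.le_iff]
        intro s _
        exact mul_le_mul' le_rfl (shearLaw_le_levelLaw hij (Q J) (A J) s)
      have hα0 : partialMixture W ν J Bᶜ = 0 := partialMixture_eq_zero fun j hj =>
        measure_mono_null (Set.compl_subset_compl.2
          (Set.subset_biUnion_of_mem (u := fun j => levelCarrier hij Θ (Q j) (A j))
            (Finset.mem_coe.2 (Finset.mem_range.2 hj))))
          (levelLaw_compl_levelCarrier hij (Q j) (A j) hΘc hκΘ)
      have hβ0 : β ({A J} * U)ᶜ = 0 := by
        simp only [β]
        rw [Measure.smul_apply, shearLaw_compl_eq_zero hij (A J) hκΘ hFc subset_rfl, smul_zero]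
      have hWJ : W J = 1 / (2 * N J) := by
        obtain ⟨J, rfl⟩ := Nat.exists_eq_add_of_le' hJ1
        rfl
      have hβmass : β.real Set.univ = (W J - W (J + 1)) / 4 := by
        have h0 : 0 ≤ W J - W (J + 1) := sub_nonneg.2 (hWa J.le_succ)
        rw [measureReal_def]
        simp only [β]
        rw [Measure.smul_apply, measure_univ, smul_eq_mul, mul_one, ENNReal.toReal_mul,
          ENNReal.toReal_ofReal h0]
        norm_num
        ring
      -- The mass of `β` is at least `(W J / 2) / 4 = 1 / (16 N J)`.
      refine average_le (hN1 J) (b := β.real Set.univ) ?_ fun k hk => ?_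
      · have h1 := hWsub J
        have h2 : (1 : ℝ) / (16 * N J) = W J / 2 / 4 := by
          rw [hWJ]
          ring
        rw [hβmass, h2]
        linarith
      · have hdisj : Disjoint (cosetUnion K) (oneJump B ({A J} * U) k) := by
          rw [Set.disjoint_left]
          intro g hgK hgB
          obtain ⟨ha1, -, ha3⟩ := ha (t J) (ht1 J)
          obtain ⟨v, hv0, hv⟩ := exists_short_vector_of_mem_oneJump (hR3 J) (hEbig J) hBS hUS
            ha1 i₀ ha3 (Finset.mem_Icc.1 hk).2 hgB
          linarith [hKr g hgK v hv0]
        have h1 := convPow_real_le hle hBc hFc hα0 hβ0 k hdisj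
        rwa [partialMixture_real_univ rfl hWa, hWJ] at h1
    -- The averages are controlled only along the times `N J`, which are unbounded; this suffices
    -- for a lower limit.
    refine liminf_le_of_frequently_le ?_ ?_
    · rw [frequently_atTop]
      intro n
      obtain ⟨J₀, hJ₀⟩ := exists_nat_gt (2 / r)
      have hNge : ∀ J, J ≤ N J := fun J => by
        induction J with
        | zero => exact Nat.zero_le _
        | succ J ih => linarith [hN2 J, hN1 J]
      let J := max (max n J₀) 1
      refine ⟨N J, ((le_max_left _ _).trans (le_max_left _ _)).trans (hNge J),
        hbound J (le_max_right _ _) ?_⟩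
      have h1 : (J₀ : ℝ) ≤ J := by exact_mod_cast (le_max_right n J₀).trans (le_max_left _ _)
      rw [div_lt_iff₀ (by positivity), mul_comm, ← div_lt_iff₀ hr]
      linarith
    · exact isBoundedUnder_of ⟨0, fun n => mul_nonneg (by positivity)
        (Finset.sum_nonneg fun k _ => measureReal_nonneg)⟩
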